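/- Let $\mathcal F^2$ be the Fock space of entire functions $f$ with $\frac1\pi\int_{\mathbb C}|f(z)|^2e^{-|z|^2}\,dV(z)<\infty$, a Hilbert space with $\langle f,g\rangle=\frac1\pi\int_{\mathbb C} f\overline g\,e^{-|z|^2}\,dV$. For entire functions $\psi,\varphi$ with $\psi\not\equiv0$ let $W_{\psi,\varphi,\max}$ be the operator $f\mapsto\psi\cdot(f\circ\varphi)$ with domain $\{f\in\mathcal F^2:\psi\cdot (f\circ\varphi)\in\mathcal F^2\}$. A closed densely defined operator $T$ is called normal if $\mathrm{dom}(T)=\mathrm{dom}(T^*)$ and $\|Tf\|=\|T^*f\|$ for all $f$ in this domain. For a conjugation $\mathcal C$ (an antilinear isometric involution), $T$ is called $\mathcal C$-selfadjoint if it is closed, densely defined and $T=\mathcal C T^*\mathcal C$, where $\mathrm{dom}(\mathcal CT^*\mathcal C)=\{f:\mathcal Cf\in\mathrm{dom}(T^*)\}$. For $a,b,c\in\mathbb C$ with $|a|=1$, $\overline a b+\overline b=0$, $|c|^2e^{|b|^2}=1$, the weighted composition conjugation $\mathcal C_{a,b,c}$ on $\mathcal F^2$ is $\mathcal C_{a,b,c}f(z)=c\,e^{bz}\,\overline{f(\overline{az+b})}$.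 1. $W_{\psi,\varphi,\max}$ is normal if and only if there are $A,B,C,D\in\mathbb C$, $C\neq0$, with $\varphi(z)=Az+B$ and $\psi(z)=Ce^{Dz}$, where either $A\ne1$ and $D=\overline B(1-A)(1-\overline A)^{-1}$, or $A=1$ and $|B|=|D|$. 2. If $W_{\psi,\varphi,\max}$ is normal, with $\varphi(z)=Az+B$ and $\psi(z)=Ce^{Dz}$ as in 1, then it is $\mathcal C_{a,b,c}$-selfadjoint for $$b=0,\quad c=1,\quad a=\begin{cases}\overline B(1-A)B^{-1}(1-\overline A)^{-1},& B\ne0,\ A\neq1,\\ DB^{-1},& B\neq0,\ A=1,\\ 1,& B=0.\end{cases}$$ In particular these $a,b,c$ satisfy the conditions above and $\mathcal C_{a,b,c}$ is a conjugation on $\mathcal F^2$. 3. The class of normal operators $W_{\psi,\varphi,\max}$ ($\psi,\varphi$ entire, $\psi\not\equiv0$) is properly contained in the class of operators $W_{\psi,\varphi,\max}$ ($\psi,\varphi$ entire, $\psi\not\equiv0$) that are $\mathcal C_{a,b,c}$-selfadjoint for some weighted composition conjugation $\mathcal C_{a,b,c}$. -/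

import Mathlib

open MeasureTheory Complex Filter Topology
open scoped ENNReal ComplexConjugate

/-- The Gaussian probability measure `π⁻¹ e^{-|z|²} dV(z)` on `ℂ`. -/
noncomputable def fockMeasure : Measure ℂ :=
  volume.withDensity fun z => ENNReal.ofReal (Real.pi⁻¹ * Real.exp (-‖z‖ ^ 2))

/-- Entire functions that are square integrable for the Gaussian measure. -/
noncomputable def fockSubmodule : Submodule ℂ (ℂ → ℂ) where
  carrier := {f | Differentiable ℂ f ∧ MemLp f 2 fockMeasure}
  zero_mem' := ⟨differentiable_const (0 : ℂ), MemLp.zero⟩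
  add_mem' hf hg := ⟨hf.1.add hg.1, hf.2.add hg.2⟩
  smul_mem' c _ hf := ⟨hf.1.const_smul c, hf.2.const_smul c⟩

/-- The Fock space `F²`. -/
def Fock : Type := ↥fockSubmodule

namespace Fock

noncomputable instance : AddCommGroup Fock := inferInstanceAs (AddCommGroup ↥fockSubmodule)
noncomputable instance : Module ℂ Fock := inferInstanceAs (Module ℂ ↥fockSubmodule)

instance : FunLike Fock ℂ ℂ where
  coe f := f.1
  coe_injective := Subtype.val_injective

theorem differentiable (f : Fock) : Differentiable ℂ (f : ℂ → ℂ) := f.2.1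
theorem memLp (f : Fock) : MemLp (f : ℂ → ℂ) 2 fockMeasure := f.2.2

@[simp] theorem coe_add (f g : Fock) : ((f + g : Fock) : ℂ → ℂ) = f + g := rfl
@[simp] theorem coe_smul (c : ℂ) (f : Fock) : ((c • f : Fock) : ℂ → ℂ) = c • (f : ℂ → ℂ) := rfl
@[simp] theorem coe_zero : ((0 : Fock) : ℂ → ℂ) = 0 := rfl
@[simp] theorem coe_sub (f g : Fock) : ((f - g : Fock) : ℂ → ℂ) = f - g := rfl

end Fock

theorem volume_absolutelyContinuous_fockMeasure : (volume : Measure ℂ) ≪ fockMeasure := by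
  apply withDensity_absolutelyContinuous'
  · exact Measurable.aemeasurable (by fun_prop)
  · refine Eventually.of_forall fun z => ?_
    simp only [ne_eq, ENNReal.ofReal_eq_zero, not_le]
    positivity

namespace Fock

instance : Measure.IsOpenPosMeasure fockMeasure :=
  volume_absolutelyContinuous_fockMeasure.isOpenPosMeasure

/-- The inclusion of the Fock space into `L²`. -/
noncomputable def toL2 : Fock →ₗ[ℂ] Lp ℂ 2 fockMeasure where
  toFun f := f.memLp.toLp f
  map_add' _ _ := rfl
  map_smul' _ _ := rfl

theorem toL2_coe (f : Fock) : (toL2 f : ℂ → ℂ) =ᵐ[fockMeasure] f := f.memLp.coeFn_toLp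

theorem toL2_eq_zero {f : Fock} (h : toL2 f = 0) : f = 0 := by
  have h1 : (f : ℂ → ℂ) =ᵐ[fockMeasure] 0 := by
    have := toL2_coe f
    rw [h] at this
    exact this.symm.trans (Lp.coeFn_zero _ _ _)
  apply DFunLike.coe_injective
  exact (f.differentiable.continuous.ae_eq_iff_eq fockMeasure continuous_const).1 h1


theorem integral_eq_inner_toL2 (f g : Fock) :
    ∫ z, conj (f z) * g z ∂fockMeasure = inner ℂ (toL2 f) (toL2 g) := by
  rw [L2.inner_def]
  refine integral_congr_ae ?_
  filter_upwards [toL2_coe f, toL2_coe g] with z h1 h2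
  rw [h1, h2, RCLike.inner_apply, mul_comm]

/-- The inner product `∫ conj (f z) * g z` with respect to the Gaussian measure (conjugate linear in
the first argument, as always in Mathlib). -/
noncomputable abbrev core : InnerProductSpace.Core ℂ Fock where
  inner f g := ∫ z, conj (f z) * g z ∂fockMeasure
  conj_inner_symm f g := by
    simp only [integral_eq_inner_toL2]; exact inner_conj_symm _ _
  re_inner_nonneg f := by
    simp only [integral_eq_inner_toL2]; exact inner_self_nonneg
  add_left f g h := by
    simp only [integral_eq_inner_toL2, map_add]; exact inner_add_left _ _ _
  smul_left f g r := by
    simp only [integral_eq_inner_toL2, map_smul]; exact inner_smul_left _ _ _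
  definite f h := by
    simp only [integral_eq_inner_toL2] at h
    exact toL2_eq_zero (inner_self_eq_zero.1 h)

noncomputable instance : NormedAddCommGroup Fock :=
  InnerProductSpace.Core.toNormedAddCommGroup (𝕜 := ℂ) (cd := core)

noncomputable instance : InnerProductSpace ℂ Fock := InnerProductSpace.ofCore core.toCore

theorem inner_eq (f g : Fock) : inner ℂ f g = ∫ z, conj (f z) * g z ∂fockMeasure := rfl

theorem norm_toL2 (f : Fock) : ‖toL2 f‖ = ‖f‖ := by
  rw [@norm_eq_sqrt_re_inner ℂ, @norm_eq_sqrt_re_inner ℂ _ _ _ _ f, inner_eq,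
    integral_eq_inner_toL2]

/-- An entire function is controlled at a point by its `L¹` norm over a disc. -/
theorem enorm_le_lintegral {f : ℂ → ℂ} (hf : Differentiable ℂ f) (z : ℂ) :
    (∫⁻ r in Set.Ioo (0 : ℝ) 1, ENNReal.ofReal r) * ‖f z‖ₑ ≤
      ∫⁻ w in Metric.ball z 1, ‖f w‖ₑ := by
  have hc : Continuous f := hf.continuous
  have h1 : ∀ r : ℝ, ‖f z‖ₑ ≤ ∫⁻ θ in Set.Ioo (-Real.pi) Real.pi,
      ‖f (z + r * (Real.cos θ + Real.sin θ * I))‖ₑ := by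
    intro r
    have hm : Real.circleAverage f z r = f z :=
      DiffContOnCl.circleAverage hf.diffContOnCl
    rw [Real.circleAverage_eq_integral_add (-Real.pi),
      intervalIntegral.integral_comp_add_right (fun θ => f (circleMap z r θ)), zero_add,
      show 2 * Real.pi + -Real.pi = Real.pi by ring,
      intervalIntegral.integral_of_le (by linarith [Real.pi_pos])] at hm
    calc ‖f z‖ₑ = ‖(2 * Real.pi)⁻¹ • ∫ θ in Set.Ioc (-Real.pi) Real.pi, f (circleMap z r θ)‖ₑ := by
          rw [hm]
      _ ≤ 1 * ∫⁻ θ in Set.Ioc (-Real.pi) Real.pi, ‖f (circleMap z r θ)‖ₑ := by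
          rw [enorm_smul]
          refine mul_le_mul' ?_ (enorm_integral_le_lintegral_enorm _)
          rw [Real.enorm_eq_ofReal (by positivity), ENNReal.ofReal_le_one]
          apply inv_le_one_of_one_le₀
          linarith [Real.pi_gt_three]
      _ = _ := by
          rw [one_mul, setLIntegral_congr Ioo_ae_eq_Ioc.symm]
          refine lintegral_congr fun θ => ?_
          rw [circleMap, Complex.exp_mul_I, ofReal_cos, ofReal_sin]
  have h2 : Measurable fun p : ℝ × ℝ =>
      ‖f (z + p.1 * (Real.cos p.2 + Real.sin p.2 * I))‖ₑ := by
    have : Continuous fun p : ℝ × ℝ => f (z + p.1 * (Real.cos p.2 + Real.sin p.2 * I)) := by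
      fun_prop
    exact this.enorm.measurable
  calc (∫⁻ r in Set.Ioo (0 : ℝ) 1, ENNReal.ofReal r) * ‖f z‖ₑ
      = ∫⁻ r in Set.Ioo (0 : ℝ) 1, ENNReal.ofReal r * ‖f z‖ₑ :=
        (lintegral_mul_const _ (by fun_prop)).symm
    _ ≤ ∫⁻ r in Set.Ioo (0 : ℝ) 1, ∫⁻ θ in Set.Ioo (-Real.pi) Real.pi, ENNReal.ofReal r *
          ‖f (z + r * (Real.cos θ + Real.sin θ * I))‖ₑ := by
        refine lintegral_mono fun r => ?_
        rw [lintegral_const_mul]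
        · gcongr
          exact h1 r
        · have h3 : Continuous fun θ : ℝ => f (z + r * (Real.cos θ + Real.sin θ * I)) := by
            fun_prop
          exact h3.enorm.measurable
    _ = ∫⁻ p in Set.Ioo (0 : ℝ) 1 ×ˢ Set.Ioo (-Real.pi) Real.pi, ENNReal.ofReal p.1 *
          ‖f (z + p.1 * (Real.cos p.2 + Real.sin p.2 * I))‖ₑ := by
        have h3 : Measurable fun p : ℝ × ℝ => ENNReal.ofReal p.1 *
            ‖f (z + p.1 * (Real.cos p.2 + Real.sin p.2 * I))‖ₑ :=
          (ENNReal.measurable_ofReal.comp measurable_fst).mul h2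
        exact (setLIntegral_prod (μ := volume) (ν := volume) _ h3.aemeasurable).symm
    _ = ∫⁻ p in Set.Ioo (0 : ℝ) 1 ×ˢ Set.Ioo (-Real.pi) Real.pi, ENNReal.ofReal p.1 •
          (Metric.ball (0 : ℂ) 1).indicator (fun w => ‖f (z + w)‖ₑ)
            (Complex.polarCoord.symm p) := by
        refine setLIntegral_congr_fun (measurableSet_Ioo.prod measurableSet_Ioo) fun p hp => ?_
        have hb : Complex.polarCoord.symm p ∈ Metric.ball (0 : ℂ) 1 := by
          rw [mem_ball_zero_iff, Complex.norm_polarCoord_symm, abs_of_pos hp.1.1]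
          exact hp.1.2
        rw [Set.indicator_of_mem hb, smul_eq_mul, Complex.polarCoord_symm_apply]
    _ ≤ ∫⁻ p in polarCoord.target, ENNReal.ofReal p.1 •
          (Metric.ball (0 : ℂ) 1).indicator (fun w => ‖f (z + w)‖ₑ)
            (Complex.polarCoord.symm p) := by
        refine lintegral_mono_set ?_
        rw [polarCoord_target]
        exact Set.prod_mono_left fun r hr => hr.1
    _ = ∫⁻ w, (Metric.ball z 1).indicator (fun w => ‖f w‖ₑ) (z + w) := by
        rw [Complex.lintegral_comp_polarCoord_symm]
        refine lintegral_congr fun w => ?_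
        by_cases hw : w ∈ Metric.ball (0 : ℂ) 1
        · rw [Set.indicator_of_mem hw, Set.indicator_of_mem]
          simpa [dist_eq_norm] using hw
        · rw [Set.indicator_of_notMem hw, Set.indicator_of_notMem]
          simpa [dist_eq_norm] using hw
    _ = ∫⁻ w in Metric.ball z 1, ‖f w‖ₑ := by
        rw [lintegral_add_left_eq_self fun w => (Metric.ball z 1).indicator (fun w => ‖f w‖ₑ) w,
          lintegral_indicator Metric.isOpen_ball.measurableSet]

/-- Point evaluations are bounded, uniformly on bounded sets. -/
theorem exists_norm_apply_le (R : ℝ) :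
    ∃ K : ℝ, 0 < K ∧ ∀ (f : Fock) (z : ℂ), ‖z‖ ≤ R → ‖f z‖ ≤ K * ‖f‖ := by
  set a : ℝ≥0∞ := ∫⁻ r in Set.Ioo (0 : ℝ) 1, ENNReal.ofReal r with ha
  have ha0 : a ≠ 0 := by
    intro h
    rw [ha, lintegral_eq_zero_iff (by fun_prop), EventuallyEq,
      ae_restrict_iff' measurableSet_Ioo] at h
    have h1 : ∀ᵐ r : ℝ, r ∉ Set.Ioo (0 : ℝ) 1 := by
      filter_upwards [h] with r hr hr'
      have := hr hr'
      simp only [Pi.zero_apply, ENNReal.ofReal_eq_zero] at this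
      exact absurd hr'.1 (not_lt.2 this)
    have h2 : volume (Set.Ioo (0 : ℝ) 1) = 0 := by
      rw [ae_iff] at h1
      simpa only [not_not, Set.ofPred_mem_eq] using h1
    simp at h2
  set m : ℝ≥0∞ := ENNReal.ofReal (Real.pi⁻¹ * Real.exp (-(|R| + 1) ^ 2)) with hm
  have hm0 : m ≠ 0 := by
    rw [hm, Ne, ENNReal.ofReal_eq_zero, not_le]
    positivity
  have hmt : m ≠ ∞ := ENNReal.ofReal_ne_top
  set v : ℝ≥0∞ := volume (Metric.ball (0 : ℂ) 1) with hv
  have hvt : v ≠ ∞ := measure_ball_lt_top.ne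
  have key : ∀ (f : Fock) (z : ℂ), ‖z‖ ≤ R →
      ‖f z‖ₑ ≤ a⁻¹ * (m⁻¹ ^ (1 / (2 : ℝ)) * v ^ (1 / (2 : ℝ))) * ‖f‖ₑ := by
    intro f z hz
    have h1 := enorm_le_lintegral f.differentiable z
    have h2 : volume.restrict (Metric.ball z 1) ≤ m⁻¹ • fockMeasure := by
      refine Measure.le_iff.2 fun s hs => ?_
      rw [Measure.smul_apply, smul_eq_mul, ← ENNReal.mul_le_iff_le_inv hm0 hmt,
        Measure.restrict_apply hs, fockMeasure]
      calc m * volume (s ∩ Metric.ball z 1) = ∫⁻ _ in s ∩ Metric.ball z 1, m := by simp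
        _ ≤ ∫⁻ w in s ∩ Metric.ball z 1,
              ENNReal.ofReal (Real.pi⁻¹ * Real.exp (-‖w‖ ^ 2)) := by
            refine setLIntegral_mono' (hs.inter Metric.isOpen_ball.measurableSet) fun w hw => ?_
            have hw1 : ‖w‖ ≤ |R| + 1 := by
              have h3 : ‖w - z‖ < 1 := by simpa [dist_eq_norm] using hw.2
              have h4 : ‖w‖ ≤ ‖w - z‖ + ‖z‖ := by simpa using norm_add_le (w - z) z
              linarith [le_abs_self R]
            rw [hm]
            gcongr
        _ ≤ ∫⁻ w in s, ENNReal.ofReal (Real.pi⁻¹ * Real.exp (-‖w‖ ^ 2)) :=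
            lintegral_mono_set Set.inter_subset_left
        _ = _ := (withDensity_apply _ hs).symm
    have h3 : ∫⁻ w in Metric.ball z 1, ‖f w‖ₑ ≤
        m⁻¹ ^ (1 / (2 : ℝ)) * eLpNorm f 2 fockMeasure * v ^ (1 / (2 : ℝ)) := by
      calc ∫⁻ w in Metric.ball z 1, ‖f w‖ₑ
          = eLpNorm f 1 (volume.restrict (Metric.ball z 1)) := eLpNorm_one_eq_lintegral_enorm.symm
        _ ≤ eLpNorm f 2 (volume.restrict (Metric.ball z 1)) *
              (volume.restrict (Metric.ball z 1)) Set.univ ^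
                (1 / (1 : ℝ≥0∞).toReal - 1 / (2 : ℝ≥0∞).toReal) :=
            eLpNorm_le_eLpNorm_mul_rpow_measure_univ (by norm_num)
              f.differentiable.continuous.aestronglyMeasurable
        _ = eLpNorm f 2 (volume.restrict (Metric.ball z 1)) * v ^ (1 / (2 : ℝ)) := by
            rw [Measure.restrict_apply_univ, Measure.addHaar_ball_center, hv]
            norm_num
        _ ≤ eLpNorm f 2 (m⁻¹ • fockMeasure) * v ^ (1 / (2 : ℝ)) := by
            gcongr
        _ = _ := by
            rw [eLpNorm_smul_measure_of_ne_top (by norm_num)]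
            simp
    have h4 : eLpNorm f 2 fockMeasure = ‖f‖ₑ := by
      rw [← ofReal_norm, ← norm_toL2, ofReal_norm, Lp.enorm_def]
      exact eLpNorm_congr_ae (toL2_coe f).symm
    rw [h4] at h3
    have hat : a ≠ ∞ := by
      have : a ≤ ∫⁻ _ in Set.Ioo (0 : ℝ) 1, 1 :=
        setLIntegral_mono' measurableSet_Ioo fun r hr => by
          simpa using hr.2.le
      refine ne_top_of_le_ne_top ?_ this
      simp
    rw [mul_assoc, ← ENNReal.mul_le_iff_le_inv ha0 hat]
    refine (h1.trans h3).trans (le_of_eq ?_)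
    ring
  set k : ℝ≥0∞ := a⁻¹ * (m⁻¹ ^ (1 / (2 : ℝ)) * v ^ (1 / (2 : ℝ))) with hk
  have hkt : k ≠ ∞ := by
    refine ENNReal.mul_ne_top (ENNReal.inv_ne_top.2 ha0) (ENNReal.mul_ne_top ?_ ?_)
    · exact ENNReal.rpow_ne_top_of_nonneg (by norm_num) (ENNReal.inv_ne_top.2 hm0)
    · exact ENNReal.rpow_ne_top_of_nonneg (by norm_num) hvt
  refine ⟨k.toReal + 1, by positivity, fun f z hz => ?_⟩
  have h1 := key f z hz
  have h2 : ‖f z‖ ≤ k.toReal * ‖f‖ := by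
    have := ENNReal.toReal_mono (ENNReal.mul_ne_top hkt enorm_ne_top) h1
    simpa [ENNReal.toReal_mul] using this
  linarith [norm_nonneg f]

instance : CompleteSpace Fock := by
  refine Metric.complete_of_cauchySeq_tendsto fun u hu => ?_
  have hloc : ∀ R : ℝ, UniformCauchySeqOn (fun n => (u n : ℂ → ℂ)) atTop (Metric.closedBall 0 R) := by
    intro R
    obtain ⟨K, hK, hb⟩ := exists_norm_apply_le R
    rw [Metric.uniformCauchySeqOn_iff]
    intro ε hε
    obtain ⟨N, hN⟩ := Metric.cauchySeq_iff.1 hu (ε / K) (by positivity)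
    refine ⟨N, fun m hm n hn z hz => ?_⟩
    have h1 := hb (u m - u n) z (by simpa using hz)
    have h2 := hN m hm n hn
    rw [dist_eq_norm] at h2 ⊢
    rw [lt_div_iff₀ hK] at h2
    have h3 : (u m - u n) z = u m z - u n z := rfl
    rw [h3] at h1
    linarith [mul_comm K ‖u m - u n‖]
  have hpt : ∀ z : ℂ, ∃ w, Tendsto (fun n => u n z) atTop (𝓝 w) := fun z =>
    cauchySeq_tendsto_of_complete ((hloc ‖z‖).cauchySeq (by simp))
  choose g hg using hpt
  have hunif : ∀ R : ℝ, TendstoUniformlyOn (fun n => (u n : ℂ → ℂ)) g atTop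
      (Metric.closedBall 0 R) := fun R =>
    (hloc R).tendstoUniformlyOn_of_tendsto fun z _ => hg z
  have hgd : Differentiable ℂ g := by
    intro z
    have h1 : TendstoLocallyUniformlyOn (fun n => (u n : ℂ → ℂ)) g atTop
        (Metric.ball 0 (‖z‖ + 1)) :=
      ((hunif (‖z‖ + 1)).mono Metric.ball_subset_closedBall).tendstoLocallyUniformlyOn
    have h2 := h1.differentiableOn
      (Eventually.of_forall fun n => (u n).differentiable.differentiableOn) Metric.isOpen_ball
    exact h2.differentiableAt (Metric.isOpen_ball.mem_nhds (by simp))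
  have hL : CauchySeq fun n => toL2 (u n) := by
    rw [Metric.cauchySeq_iff] at hu ⊢
    intro ε hε
    obtain ⟨N, hN⟩ := hu ε hε
    refine ⟨N, fun m hm n hn => ?_⟩
    rw [dist_eq_norm, ← map_sub, norm_toL2, ← dist_eq_norm]
    exact hN m hm n hn
  obtain ⟨F, hF⟩ := cauchySeq_tendsto_of_complete hL
  have hFg : (F : ℂ → ℂ) =ᵐ[fockMeasure] g := by
    obtain ⟨ns, hns, hae⟩ := (tendstoInMeasure_of_tendsto_Lp hF).exists_seq_tendsto_ae
    have hco : ∀ᵐ z ∂fockMeasure, ∀ n, (toL2 (u n) : ℂ → ℂ) z = u n z :=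
      ae_all_iff.2 fun n => toL2_coe (u n)
    filter_upwards [hae, hco] with z h1 h2
    simp only [h2] at h1
    exact tendsto_nhds_unique h1 ((hg z).comp hns.tendsto_atTop)
  let G : Fock := ⟨g, hgd, (memLp_congr_ae hFg).1 (Lp.memLp F)⟩
  have hGF : toL2 G = F := by
    apply Lp.ext
    exact (toL2_coe G).trans hFg.symm
  refine ⟨G, ?_⟩
  rw [tendsto_iff_norm_sub_tendsto_zero] at hF ⊢
  simpa only [← hGF, ← map_sub, norm_toL2] using hF

end Fock

/-- The maximal weighted composition operator `f ↦ ψ · f ∘ φ` on the Fock space: its domain consists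
of all `f` in the Fock space for which `ψ · f ∘ φ` is again in the Fock space. -/
noncomputable def maximalWCO (ψ φ : ℂ → ℂ) : Fock →ₗ.[ℂ] Fock where
  domain :=
    { carrier := {f | (fun z => ψ z * f (φ z)) ∈ fockSubmodule}
      zero_mem' := by
        have h : (fun z => ψ z * (0 : Fock) (φ z)) = 0 := by ext z; simp
        rw [Set.mem_ofPred_eq, h]
        exact fockSubmodule.zero_mem
      add_mem' := fun {f g} hf hg => by
        have h : (fun z => ψ z * (f + g) (φ z)) =
            (fun z => ψ z * f (φ z)) + fun z => ψ z * g (φ z) := by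
          ext z; simp [mul_add]
        rw [Set.mem_ofPred_eq, h]
        exact fockSubmodule.add_mem hf hg
      smul_mem' := fun c f hf => by
        have h : (fun z => ψ z * (c • f) (φ z)) = c • fun z => ψ z * f (φ z) := by
          ext z; simp [mul_left_comm]
        rw [Set.mem_ofPred_eq, h]
        exact fockSubmodule.smul_mem c hf }
  toFun :=
    { toFun := fun f => (⟨fun z => ψ z * f.1 (φ z), f.2⟩ : ↥fockSubmodule)
      map_add' := fun f g => by
        apply Subtype.ext
        ext z
        exact mul_add _ _ _
      map_smul' := fun c f => by
        apply Subtype.ext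
        ext z
        exact mul_left_comm _ _ _ }

section Operators

variable {H : Type*} [NormedAddCommGroup H] [InnerProductSpace ℂ H]

/-- A conjugation: an antilinear, isometric, involutive map. -/
structure Conjugation (H : Type*) [NormedAddCommGroup H] [InnerProductSpace ℂ H] where
  toFun : H →ₗᵢ⋆[ℂ] H
  involutive : ∀ x, toFun (toFun x) = x

instance : CoeFun (Conjugation H) fun _ => H → H := ⟨fun 𝒞 => 𝒞.toFun⟩

/-- The operator `𝒞 S 𝒞`, with domain `{x | 𝒞 x ∈ dom S}`. -/
def Conjugation.sandwich (𝒞 : Conjugation H) (S : H →ₗ.[ℂ] H) : H →ₗ.[ℂ] H where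
  domain := S.domain.comap 𝒞.toFun.toLinearMap
  toFun :=
    { toFun := fun x => 𝒞 (S ⟨𝒞 x.1, x.2⟩)
      map_add' := fun x y => by
        rw [← map_add, ← S.map_add]
        congr 2
        exact Subtype.ext (map_add 𝒞.toFun _ _)
      map_smul' := fun c x => by
        have h : (⟨𝒞 (c • x).1, (c • x).2⟩ : S.domain) =
            (starRingEnd ℂ c) • (⟨𝒞 x.1, x.2⟩ : S.domain) :=
          Subtype.ext (map_smulₛₗ 𝒞.toFun c x.1)
        rw [h, S.map_smul, map_smulₛₗ]
        simp }

variable [CompleteSpace H]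

/-- `T` is closed, densely defined, and `T = 𝒞 T† 𝒞`. -/
def Conjugation.IsSelfAdjoint (𝒞 : Conjugation H) (T : H →ₗ.[ℂ] H) : Prop :=
  T.IsClosed ∧ Dense (T.domain : Set H) ∧ T = 𝒞.sandwich T.adjoint

/-- `T` is closed, densely defined, `dom T = dom T†` and `‖T x‖ = ‖T† x‖` on this domain. -/
def IsNormalOperator (T : H →ₗ.[ℂ] H) : Prop :=
  T.IsClosed ∧ Dense (T.domain : Set H) ∧ T.domain = T.adjoint.domain ∧
    ∀ (x : H) (hx : x ∈ T.domain) (hx' : x ∈ T.adjoint.domain),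
      ‖T ⟨x, hx⟩‖ = ‖T.adjoint ⟨x, hx'⟩‖

end Operators

/-- `𝒞` is the weighted composition conjugation
`𝒞 f(z) = c e^{bz} conj (f (conj (a z + b)))`, where `|a| = 1`, `conj a * b + conj b = 0` and
`|c|² e^{|b|²} = 1`. -/
structure IsWeightedCompositionConjugation (𝒞 : Conjugation Fock) (a b c : ℂ) : Prop where
  norm_a : ‖a‖ = 1
  ab : conj a * b + conj b = 0
  bc : ‖c‖ ^ 2 * Real.exp (‖b‖ ^ 2) = 1
  apply_eq : ∀ (f : Fock) (z : ℂ), 𝒞 f z = c * exp (b * z) * conj (f (conj (a * z + b)))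

/-- `φ(z) = A z + B` and `ψ(z) = C e^{D z}` with `C ≠ 0`, where either `A ≠ 1` and
`D = conj B (1 - A) (1 - conj A)⁻¹`, or `A = 1` and `|B| = |D|`. -/
structure HasNormalSymbols (ψ φ : ℂ → ℂ) (A B C D : ℂ) : Prop where
  phi_eq : ∀ z, φ z = A * z + B
  psi_eq : ∀ z, ψ z = C * exp (D * z)
  C_ne_zero : C ≠ 0
  cases : (A ≠ 1 ∧ D = conj B * (1 - A) * (1 - conj A)⁻¹) ∨ (A = 1 ∧ ‖B‖ = ‖D‖)

open Classical in
/-- The parameter `a` of the conjugation attached to a normal operator. -/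
noncomputable def normalParam (A B D : ℂ) : ℂ :=
  if B = 0 then 1
  else if A = 1 then D * B⁻¹
  else conj B * (1 - A) * B⁻¹ * (1 - conj A)⁻¹

/-! ### The Gaussian measure -/

/-! Everything rests on the kernels $K_w(z)=e^{\bar w z}$. If $T=W_{\psi,\varphi,\max}$ is normal,
then $T^*K_w=\overline{\psi(w)}K_{\varphi(w)}$ forces $K_w\in\mathrm{dom}(T)$ and
$\|TK_w\|=|\psi(w)|e^{|\varphi(w)|^2/2}$. With $|g(z)|\le\|g\|e^{|z|^2/2}$ this becomes an
inequality in $w,z$ so rigid that $\log\psi$ and $\varphi$ are first quadratic polynomials, then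
affine (`exists_affine_of_growth`). The exact norm identity then gives $|B|=|D|$ and $\overline
B(1-A)=D(1-\overline A)$, which is equivalent to the two cases of the theorem.

Conversely, for affine symbols $T$ sends kernels to multiples of kernels, and so does the expected
adjoint, with coefficients $(\overline A,\overline D,\overline C,\overline B)$. Since $T$ may be
unbounded, the point is to pass from kernels to the whole maximal domain: the kernels span a core
(`mem_topologicalClosure_span_kernel`). Indeed, an element of the graph orthogonal to all
$(K_w,TK_w)$ has a first component $f$ with $f(|A|^2w+\beta)=-\kappa e^{-\overline\beta w}f(w)$,
$\kappa>0$, and the negative sign excludes nonzero solutions in the Fock space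
(`Fock.eq_zero_of_comp_affine_eq`). This identifies $T^*$; equality of the Gram matrices of $(TK_w)$
and $(T^*K_w)$ then yields normality.

For the conjugations with $b=0$, $c=1$, selfadjointness needs only $D=aB$ with $|a|=1$. This is
solvable whenever $|B|=|D|$, whatever $A$ is, so non-normal examples exist: $A=0$, $B=1$, $D=-1$. -/

theorem integral_fockMeasure (F : ℂ → ℂ) :
    ∫ z, F z ∂fockMeasure = ∫ z, (Real.pi⁻¹ * Real.exp (-‖z‖ ^ 2)) • F z := by
  rw [fockMeasure, integral_withDensity_eq_integral_toReal_smul (by fun_prop) (by simp)]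
  refine integral_congr_ae (Eventually.of_forall fun z => ?_)
  simp only
  rw [ENNReal.toReal_ofReal (by positivity)]

theorem integrable_fockMeasure_iff {E : Type*} [NormedAddCommGroup E] [NormedSpace ℝ E]
    {F : ℂ → E} : Integrable F fockMeasure ↔
      Integrable fun z => (Real.pi⁻¹ * Real.exp (-‖z‖ ^ 2)) • F z := by
  rw [fockMeasure, integrable_withDensity_iff_integrable_smul' (by fun_prop) (by simp)]
  refine integrable_congr (Eventually.of_forall fun z => ?_)
  simp only
  rw [ENNReal.toReal_ofReal (by positivity)]

theorem integrable_exp_neg_norm_sq : Integrable fun z : ℂ => Real.exp (-‖z‖ ^ 2) := by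
  have h := (GaussianFourier.integrable_cexp_neg_mul_sq_norm_add (V := ℂ) (b := 1) (by simp) 0 0).norm
  refine h.congr (Eventually.of_forall fun z => ?_)
  simp [Complex.norm_exp, ← ofReal_pow]

instance isProbabilityMeasure_fockMeasure : IsProbabilityMeasure fockMeasure := by
  constructor
  have h1 : Integrable fun z : ℂ => Real.pi⁻¹ * Real.exp (-‖z‖ ^ 2) :=
    integrable_exp_neg_norm_sq.const_mul _
  rw [fockMeasure, withDensity_apply _ MeasurableSet.univ, Measure.restrict_univ,
    ← ofReal_integral_eq_lintegral_ofReal h1 (Eventually.of_forall fun z => by positivity),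
    integral_const_mul]
  have h2 := GaussianFourier.integral_rexp_neg_mul_sq_norm (V := ℂ) one_pos
  simp only [neg_mul, one_mul, div_one, Complex.finrank_real_complex] at h2
  rw [h2]
  norm_num

/-- Both Lebesgue measure and the density are invariant under real-linear isometries. Used for
rotations and for $z\mapsto\overline{az}$. -/
theorem measurePreserving_fockMeasure (e : ℂ ≃ₗᵢ[ℝ] ℂ) :
    MeasurePreserving e fockMeasure fockMeasure := by
  refine ⟨e.continuous.measurable, ?_⟩
  ext s hs
  rw [Measure.map_apply e.continuous.measurable hs, fockMeasure,
    withDensity_apply _ (e.continuous.measurable hs), withDensity_apply _ hs,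
    ← e.measurePreserving.setLIntegral_comp_preimage hs (by fun_prop)]
  simp

/-- The mean value property of entire functions for the Gaussian measure. -/
theorem integral_fockMeasure_of_differentiable {g : ℂ → ℂ} (hg : Differentiable ℂ g)
    (hi : Integrable g fockMeasure) : ∫ z, g z ∂fockMeasure = g 0 := by
  have hrot : ∀ θ : ℝ, MeasurePreserving (fun z => circleMap 0 1 θ * z) fockMeasure fockMeasure := by
    intro θ
    have h := measurePreserving_fockMeasure
      (rotation ⟨circleMap 0 1 θ, by simp [Submonoid.unitSphere]⟩)
    exact h
  have hc : Continuous fun p : ℝ × ℂ => g (circleMap 0 1 p.1 * p.2) := by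
    have := hg.continuous
    unfold circleMap
    fun_prop
  have : IsFiniteMeasure (volume.restrict (Set.uIoc 0 (2 * Real.pi))) :=
    ⟨by rw [Measure.restrict_apply_univ, Set.uIoc]; exact measure_Ioc_lt_top⟩
  have hint : Integrable (Function.uncurry fun (θ : ℝ) (z : ℂ) => g (circleMap 0 1 θ * z))
      ((volume.restrict (Set.uIoc 0 (2 * Real.pi))).prod fockMeasure) := by
    refine (integrable_prod_iff (by exact hc.aestronglyMeasurable)).2 ⟨?_, ?_⟩
    · refine Eventually.of_forall fun θ => ?_
      exact (hrot θ).integrable_comp_of_integrable hi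
    · have : ∀ θ : ℝ, ∫ z, ‖g (circleMap 0 1 θ * z)‖ ∂fockMeasure = ∫ z, ‖g z‖ ∂fockMeasure := by
        intro θ
        have hcg : AEStronglyMeasurable (fun z => ‖g z‖) fockMeasure :=
          hg.continuous.norm.aestronglyMeasurable
        have := integral_map (hrot θ).measurable.aemeasurable
          (by rw [(hrot θ).map_eq]; exact hcg)
        rw [(hrot θ).map_eq] at this
        exact this.symm
      simp only [Function.uncurry, this]
      exact integrable_const _
  -- Averaging over rotations leaves the integral unchanged; by Fubini it also replaces $g(z)$ by
  -- its mean over the circle through $z$, which is $g(0)$.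
  have hswap := MeasureTheory.intervalIntegral_integral_swap hint
  have h1 : ∀ θ : ℝ, ∫ z, g (circleMap 0 1 θ * z) ∂fockMeasure = ∫ z, g z ∂fockMeasure := by
    intro θ
    have := integral_map (hrot θ).measurable.aemeasurable
      (by rw [(hrot θ).map_eq]; exact hg.continuous.aestronglyMeasurable (μ := fockMeasure))
    rw [(hrot θ).map_eq] at this
    exact this.symm
  have h2 : ∀ z : ℂ, ∫ θ in (0 : ℝ)..2 * Real.pi, g (circleMap 0 1 θ * z) =
      (2 * Real.pi) • g 0 := by
    intro z
    have hd : Differentiable ℂ fun u => g (u * z) := by fun_prop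
    have hm : Real.circleAverage (fun u => g (u * z)) 0 1 = g (0 * z) :=
      DiffContOnCl.circleAverage hd.diffContOnCl
    rw [Real.circleAverage_def, zero_mul] at hm
    rw [← hm, smul_smul, mul_inv_cancel₀ (by positivity), one_smul]
  simp only [h1, h2] at hswap
  simp only [intervalIntegral.integral_const, integral_const, probReal_univ, one_smul,
    sub_zero] at hswap
  exact smul_right_injective ℂ (by positivity : (2 * Real.pi) ≠ 0) hswap

/-! ### Reproducing kernels -/

namespace Fock

theorem ext {f g : Fock} (h : ∀ z, f z = g z) : f = g := DFunLike.ext _ _ h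

/-- Completing the square: $|e^{wz}|^2e^{-|z|^2}=e^{|w|^2}e^{-|z-\overline w|^2}$. -/
theorem memLp_exp (w : ℂ) : MemLp (fun z => exp (w * z)) 2 fockMeasure := by
  rw [memLp_two_iff_integrable_sq_norm (by
    exact (by fun_prop : Continuous fun z : ℂ => exp (w * z)).aestronglyMeasurable),
    integrable_fockMeasure_iff]
  have h := ((integrable_exp_neg_norm_sq.comp_sub_right (conj w)).const_mul
    (Real.pi⁻¹ * Real.exp (‖w‖ ^ 2)))
  refine h.congr (Eventually.of_forall fun z => ?_)
  simp only [smul_eq_mul, mul_assoc, Complex.norm_exp, ← Real.exp_add, ← Real.exp_nat_mul]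
  congr 2
  simp only [Complex.sq_norm, normSq_apply, sub_re, sub_im, conj_re, conj_im, mul_re]
  push_cast
  ring

/-- The function `z ↦ e^{w z}`, as an element of the Fock space. -/
noncomputable def expFun (w : ℂ) : Fock :=
  (⟨fun z => exp (w * z), by fun_prop, memLp_exp w⟩ : ↥fockSubmodule)

/-- The reproducing kernel `z ↦ e^{conj w z}` of the Fock space. -/
noncomputable def kernel (w : ℂ) : Fock := expFun (conj w)

@[simp] theorem kernel_apply (w z : ℂ) : kernel w z = exp (conj w * z) := rfl

/-- The reproducing property. -/
@[simp] theorem inner_kernel (w : ℂ) (f : Fock) : inner ℂ (kernel w) f = f w := by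
  have hi : Integrable (fun z => conj (kernel w z) * f z) fockMeasure := by
    have := (kernel w).memLp.star.integrable_mul f.memLp
    exact this
  -- Translating by $w$ absorbs the conjugated kernel into the Gaussian and leaves the entire
  -- function $e^{-\overline wz}f(z+w)$, whose value at $0$ is $f(w)$.
  have key : ∀ z : ℂ, (Real.pi⁻¹ * Real.exp (-‖z + w‖ ^ 2)) • (conj (kernel w (z + w)) * f (z + w)) =
      (Real.pi⁻¹ * Real.exp (-‖z‖ ^ 2)) • (exp (-conj w * z) * f (z + w)) := by
    intro z
    simp only [real_smul, ofReal_mul, ofReal_exp, kernel_apply, ← exp_conj, ← mul_assoc]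
    rw [mul_assoc _ (exp _) (exp _), mul_assoc _ (exp _) (exp _), ← exp_add, ← exp_add]
    congr 3
    push_cast
    simp only [← Complex.mul_conj', map_add, map_mul, conj_conj]
    ring
  rw [inner_eq, integral_fockMeasure, ← integral_add_right_eq_self _ w]
  rw [integrable_fockMeasure_iff] at hi
  have hi' := hi.comp_add_right w
  simp only [key] at hi' ⊢
  rw [← integrable_fockMeasure_iff] at hi'
  rw [← integral_fockMeasure, integral_fockMeasure_of_differentiable _ hi']
  · simp
  · have := f.differentiable
    fun_prop

theorem norm_kernel_sq (w : ℂ) : ‖kernel w‖ ^ 2 = Real.exp (‖w‖ ^ 2) := by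
  have h : ((‖kernel w‖ ^ 2 : ℝ) : ℂ) = inner ℂ (kernel w) (kernel w) := by
    rw [inner_self_eq_norm_sq_to_K]; norm_cast
  rw [inner_kernel, kernel_apply, Complex.conj_mul'] at h
  exact_mod_cast h

theorem norm_kernel (w : ℂ) : ‖kernel w‖ = Real.exp (‖w‖ ^ 2 / 2) := by
  rw [← sq_eq_sq₀ (norm_nonneg _) (Real.exp_pos _).le, norm_kernel_sq, ← Real.exp_nat_mul]
  congr 1
  push_cast
  ring

theorem norm_apply_le (f : Fock) (z : ℂ) : ‖f z‖ ≤ ‖f‖ * Real.exp (‖z‖ ^ 2 / 2) := by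
  rw [← inner_kernel, mul_comm, ← norm_kernel]
  exact norm_inner_le_norm _ _

theorem continuous_apply (z : ℂ) : Continuous fun f : Fock => f z := by
  simp only [← inner_kernel]
  fun_prop

theorem eq_zero_of_inner_kernel {f : Fock} (h : ∀ w, inner ℂ (kernel w) f = 0) : f = 0 :=
  ext fun z => by rw [← inner_kernel, h]; rfl

end Fock

/-! ### A functional equation -/

/-- Compare derivatives at $0$: the $n$-th one is killed by $\alpha^n+k>0$. -/
theorem Differentiable.eq_zero_of_comp_mul_eq_neg_mul {h : ℂ → ℂ} (hd : Differentiable ℂ h)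
    {α k : ℝ} (hα : 0 ≤ α) (hk : 0 < k) (he : ∀ u, h (α * u) = -k * h u) : h = 0 := by
  have hn : ∀ n, iteratedDeriv n h 0 = 0 := by
    intro n
    have h1 : iteratedDeriv n (fun u => h (α * u)) 0 = (α : ℂ) ^ n * iteratedDeriv n h 0 := by
      rw [iteratedDeriv_comp_const_mul hd.contDiff]
      simp
    have h2 : iteratedDeriv n (fun u => h (α * u)) 0 = -k * iteratedDeriv n h 0 := by
      simp only [he]
      rw [iteratedDeriv_const_mul_field]
    have h3 : ((α ^ n + k : ℝ) : ℂ) * iteratedDeriv n h 0 = 0 := by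
      push_cast
      linear_combination h2 - h1
    refine (mul_eq_zero.1 h3).resolve_left ?_
    exact_mod_cast (by positivity : α ^ n + k ≠ 0)
  ext z
  rw [← Complex.taylorSeries_eq_of_entire' 0 z hd]
  simp [hn]

/-- $|G|$ has period $1$, so the bound on the strip is global; by Liouville $G$ is constant, and a
constant equal to its negative is $0$. -/
theorem Differentiable.eq_zero_of_antiperiodic {G : ℂ → ℂ} (hd : Differentiable ℂ G)
    (hG : ∀ t, G (t + 1) = -G t) {M : ℝ} (hM : ∀ t : ℂ, 0 ≤ t.re → t.re ≤ 1 → ‖G t‖ ≤ M) :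
    G = 0 := by
  have hp : Function.Periodic (fun t => ‖G t‖) 1 := fun t => by simp [hG]
  have hb : Bornology.IsBounded (Set.range G) := by
    rw [isBounded_iff_forall_norm_le]
    refine ⟨M, ?_⟩
    rintro _ ⟨t, rfl⟩
    have h1 : ‖G (t - (⌊t.re⌋ : ℤ) * 1)‖ = ‖G t‖ := hp.sub_int_mul_eq ⌊t.re⌋
    rw [← h1]
    refine hM _ ?_ ?_
    · simp
    · simpa using (Int.fract_lt_one t.re).le
  ext t
  have h2 := hd.apply_eq_apply_of_bounded hb (t + 1) t
  rw [hG] at h2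
  exact neg_eq_self.1 h2

namespace Fock

/-- For $\beta\ne0$, a Gaussian factor along the line $t\mapsto\beta t$ turns the equation into
antiperiodicity. The constant $l$ absorbs $k$. The Fock growth bound gives the exponent
$|\beta|^2(\mathrm{Re}\,t^2+|t|^2)/2=|\beta|^2(\mathrm{Re}\,t)^2$, bounded on the strip. -/
theorem eq_zero_of_comp_add_eq {f : Fock} {k : ℝ} {β : ℂ} (hk : 0 < k)
    (h : ∀ z, f (z + β) = -k * exp (-conj β * z) * f z) : f = 0 := by
  have hf := f.differentiable
  rcases eq_or_ne β 0 with rfl | hβ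
  · refine ext fun z => ?_
    have h1 := h z
    simp only [add_zero, map_zero, neg_zero, zero_mul, exp_zero, mul_one] at h1
    have h3 : ((1 + k : ℝ) : ℂ) * f z = 0 := by
      push_cast
      linear_combination h1
    exact (mul_eq_zero.1 h3).resolve_left (by exact_mod_cast (by positivity : 1 + k ≠ 0))
  · set l : ℝ := Real.log k + ‖β‖ ^ 2 / 2 with hl
    have hb : conj β * β = (‖β‖ : ℂ) ^ 2 := conj_mul' β
    have hkl : (k : ℂ) = exp (l - (‖β‖ : ℂ) ^ 2 / 2) := by
      rw [hl]; push_cast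
      rw [add_sub_cancel_right, ← ofReal_exp, Real.exp_log hk]
    have hG0 : (fun t => exp ((‖β‖ : ℂ) ^ 2 * t ^ 2 / 2 - l * t) * f (β * t)) = 0 := by
      refine Differentiable.eq_zero_of_antiperiodic (by fun_prop)
        (M := ‖f‖ * Real.exp (‖β‖ ^ 2 + |l|)) (fun t => ?_) (fun t h0 h1 => ?_)
      · have h1 := h (β * t)
        rw [show β * (t + 1) = β * t + β by ring, h1, hkl,
          show -conj β * (β * t) = -((‖β‖ : ℂ) ^ 2 * t) by rw [← hb]; ring]
        rw [neg_mul, neg_mul, mul_neg, ← mul_assoc, ← mul_assoc, ← exp_add, ← exp_add]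
        congr 3
        ring
      · rw [norm_mul, norm_exp]
        calc _ ≤ Real.exp ((‖β‖ : ℂ) ^ 2 * t ^ 2 / 2 - l * t).re *
              (‖f‖ * Real.exp (‖β * t‖ ^ 2 / 2)) := by
              gcongr
              exact norm_apply_le _ _
          _ = ‖f‖ * Real.exp (‖β‖ ^ 2 * t.re ^ 2 - l * t.re) := by
              rw [mul_left_comm, ← Real.exp_add]
              congr 2
              rw [norm_mul, mul_pow, Complex.sq_norm t, normSq_apply]
              simp [← ofReal_pow, pow_two t]
              ring
          _ ≤ _ := by
              have h2 : |l * t.re| ≤ |l| := by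
                rw [abs_mul, abs_of_nonneg h0]
                nlinarith [abs_nonneg l]
              have h3 : ‖β‖ ^ 2 * t.re ^ 2 ≤ ‖β‖ ^ 2 * 1 := by
                gcongr
                nlinarith
              gcongr
              linarith [neg_abs_le (l * t.re)]
    refine ext fun z => ?_
    have h2 := congrFun hG0 (z / β)
    simp only [Pi.zero_apply, mul_eq_zero, exp_ne_zero, false_or] at h2
    rwa [mul_div_cancel₀ _ hβ] at h2

theorem eq_zero_of_comp_affine_eq {f : Fock} {α k : ℝ} {β : ℂ} (hα : 0 ≤ α) (hk : 0 < k)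
    (h : ∀ z, f (α * z + β) = -k * exp (-conj β * z) * f z) : f = 0 := by
  rcases eq_or_ne α 1 with rfl | hα1
  · exact eq_zero_of_comp_add_eq hk (by simpa using h)
  have hf := f.differentiable
  have h1α : (1 - α : ℂ) ≠ 0 := by
    rw [sub_ne_zero]
    exact_mod_cast hα1.symm
  -- The fixed point of $z\mapsto\alpha z+\beta$. Recentring there, with the factor
  -- $e^{-\overline{z_0}u}$, removes the exponential and leaves a pure dilation equation.
  set z₀ : ℂ := β / (1 - α) with hz₀
  have hβ : β = z₀ * (1 - α) := by rw [hz₀]; field_simp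
  have hβc : conj β = conj z₀ * (1 - α) := by rw [hβ]; simp
  have h0 : (fun u => exp (-conj z₀ * u) * f (u + z₀)) = 0 := by
    refine Differentiable.eq_zero_of_comp_mul_eq_neg_mul (by fun_prop) hα
      (k := k * Real.exp (-(‖z₀‖ ^ 2 * (1 - α)))) (by positivity) (fun u => ?_)
    have h1 := h (u + z₀)
    rw [show (α : ℂ) * u + z₀ = α * (u + z₀) + β by rw [hβ]; ring, h1]
    have h2 : exp (-conj z₀ * (α * u)) * exp (-conj β * (u + z₀)) =
        exp (-((‖z₀‖ : ℂ) ^ 2 * (1 - α))) * exp (-conj z₀ * u) := by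
      rw [← exp_add, ← exp_add, hβc, ← conj_mul']
      congr 1
      ring
    push_cast
    linear_combination -(k * f (u + z₀)) * h2
  refine ext fun z => ?_
  have h2 := congrFun h0 (z - z₀)
  simp only [Pi.zero_apply, mul_eq_zero, exp_ne_zero, false_or, sub_add_cancel] at h2
  exact h2

end Fock

/-! ### Maximal weighted composition operators -/

theorem maximalWCO_apply {ψ φ : ℂ → ℂ} (f : (maximalWCO ψ φ).domain) (z : ℂ) :
    maximalWCO ψ φ f z = ψ z * f.1 (φ z) := rfl

theorem mem_maximalWCO_domain_iff {ψ φ : ℂ → ℂ} {f : Fock} :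
    f ∈ (maximalWCO ψ φ).domain ↔ ∃ g : Fock, ∀ z, g z = ψ z * f (φ z) := by
  constructor
  · exact fun h => ⟨maximalWCO ψ φ ⟨f, h⟩, fun z => rfl⟩
  · rintro ⟨g, hg⟩
    have h : (fun z => ψ z * f (φ z)) = g := funext fun z => (hg z).symm
    change (fun z => ψ z * f (φ z)) ∈ fockSubmodule
    rw [h]
    exact g.2

theorem maximalWCO_eq_of_forall {ψ φ : ℂ → ℂ} {f : (maximalWCO ψ φ).domain} {g : Fock}
    (h : ∀ z, g z = ψ z * f.1 (φ z)) : maximalWCO ψ φ f = g :=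
  Fock.ext fun z => (h z).symm

theorem mem_maximalWCO_graph_iff {ψ φ : ℂ → ℂ} {p : Fock × Fock} :
    p ∈ (maximalWCO ψ φ).graph ↔ ∀ z, p.2 z = ψ z * p.1 (φ z) := by
  rw [LinearPMap.mem_graph_iff]
  constructor
  · rintro ⟨y, h1, h2⟩ z
    rw [← h1, ← h2, maximalWCO_apply]
  · intro h
    exact ⟨⟨p.1, mem_maximalWCO_domain_iff.2 ⟨p.2, h⟩⟩, rfl, maximalWCO_eq_of_forall h⟩

theorem maximalWCO_isClosed (ψ φ : ℂ → ℂ) : (maximalWCO ψ φ).IsClosed := by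
  have h : ((maximalWCO ψ φ).graph : Set (Fock × Fock)) =
      ⋂ z, {p | p.2 z = ψ z * p.1 (φ z)} := by
    ext p
    simp only [SetLike.mem_coe, mem_maximalWCO_graph_iff, Set.mem_iInter, Set.mem_ofPred_eq]
  rw [LinearPMap.IsClosed, h]
  refine isClosed_iInter fun z => isClosed_eq ?_ ?_
  · exact (Fock.continuous_apply z).comp continuous_snd
  · exact continuous_const.mul ((Fock.continuous_apply (φ z)).comp continuous_fst)

theorem Fock.dense_of_kernel_mem {p : Submodule ℂ Fock} (h : ∀ w, Fock.kernel w ∈ p) :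
    Dense (p : Set Fock) := by
  rw [Submodule.dense_iff_topologicalClosure_eq_top, Submodule.topologicalClosure_eq_top_iff,
    Submodule.eq_bot_iff]
  exact fun f hf => Fock.eq_zero_of_inner_kernel fun w => hf _ (h w)

/-! ### Affine symbols -/

/-- The image of the kernel at `w` under the weighted composition operator with symbols
`ψ z = C e^{D z}` and `φ z = A z + B`. -/
noncomputable def imageKernel (A B C D w : ℂ) : Fock :=
  (C * exp (conj w * B)) • Fock.kernel (conj D + w * conj A)

theorem imageKernel_apply (A B C D w z : ℂ) :
    imageKernel A B C D w z = C * exp (D * z) * Fock.kernel w (A * z + B) := by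
  have h : exp (conj w * B) * exp ((D + conj w * A) * z) = exp (D * z) *
      exp (conj w * (A * z + B)) := by
    rw [← exp_add, ← exp_add]
    ring_nf
  simp only [imageKernel, Fock.coe_smul, Pi.smul_apply, Fock.kernel_apply, smul_eq_mul, map_add,
    map_mul, conj_conj]
  linear_combination C * h

/-- The right side is the weighted composition operator with coefficients $(\overline A,\overline
D,\overline C,\overline B)$ applied to $g$: this is where the formula for the adjoint comes from. -/
theorem inner_imageKernel (A B C D w : ℂ) (g : Fock) : inner ℂ (imageKernel A B C D w) g =
    conj C * exp (conj B * w) * g (conj A * w + conj D) := by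
  rw [imageKernel, inner_smul_left, Fock.inner_kernel, map_mul, ← exp_conj, map_mul, conj_conj,
    mul_comm w, add_comm (conj D), mul_comm w]

section Affine

variable {A B C D : ℂ}

theorem kernel_mem_domain (w : ℂ) :
    Fock.kernel w ∈ (maximalWCO (fun z => C * exp (D * z)) fun z => A * z + B).domain :=
  mem_maximalWCO_domain_iff.2 ⟨imageKernel A B C D w, imageKernel_apply A B C D w⟩

theorem maximalWCO_affine_dense :
    Dense ((maximalWCO (fun z => C * exp (D * z)) fun z => A * z + B).domain : Set Fock) :=
  Fock.dense_of_kernel_mem kernel_mem_domain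

/-- The kernels span a core of the maximal operator with affine symbols. -/
theorem mem_topologicalClosure_span_kernel (hC : C ≠ 0) {f g : Fock}
    (h : ∀ z, g z = C * exp (D * z) * f (A * z + B)) :
    WithLp.toLp 2 (f, g) ∈ (Submodule.span ℂ (Set.range fun w =>
      WithLp.toLp 2 (Fock.kernel w, imageKernel A B C D w))).topologicalClosure := by
  set K := Submodule.span ℂ (Set.range fun w =>
      WithLp.toLp 2 (Fock.kernel w, imageKernel A B C D w)) with hK
  let G : Submodule ℂ (WithLp 2 (Fock × Fock)) :=
    (maximalWCO (fun z => C * exp (D * z)) fun z => A * z + B).graph.comap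
      (WithLp.linearEquiv 2 ℂ (Fock × Fock)).toLinearMap
  have hG : ∀ p, p ∈ G ↔ ∀ z, p.snd z = C * exp (D * z) * p.fst (A * z + B) := fun p =>
    mem_maximalWCO_graph_iff
  have hGc : IsClosed (G : Set (WithLp 2 (Fock × Fock))) :=
    (maximalWCO_isClosed _ _).preimage (WithLp.prod_continuous_ofLp 2 Fock Fock)
  have hKG : K.topologicalClosure ≤ G := by
    refine Submodule.topologicalClosure_minimal _ ?_ hGc
    rw [hK, Submodule.span_le]
    rintro _ ⟨w, rfl⟩
    exact (hG _).2 (imageKernel_apply A B C D w)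
  have hKc : CompleteSpace K.topologicalClosure :=
    K.isClosed_topologicalClosure.completeSpace_coe
  set p : WithLp 2 (Fock × Fock) := WithLp.toLp 2 (f, g) with hp
  have hpG : p ∈ G := (hG _).2 h
  -- The component of $p$ orthogonal to the kernel part of the graph. It is again in the graph, so
  -- its second entry is $T$ of its first; orthogonality gives formally $q_1=-T^*q_2=-T^*Tq_1$,
  -- which should force $q=0$.
  set q := p - K.topologicalClosure.starProjection p with hq
  have hqG : q ∈ G := G.sub_mem hpG (hKG (K.topologicalClosure.starProjection_apply_mem p))
  have hqK : q ∈ Kᗮ := by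
    rw [← Submodule.orthogonal_closure]
    exact K.topologicalClosure.sub_starProjection_mem_orthogonal p
  have horth : ∀ w, q.fst w + conj C * exp (conj B * w) * q.snd (conj A * w + conj D) = 0 := by
    intro w
    have h1 := hqK _ (Submodule.subset_span ⟨w, rfl⟩)
    rw [WithLp.prod_inner_apply] at h1
    rw [← inner_imageKernel, ← Fock.inner_kernel]
    exact h1
  rw [hG] at hqG
  set k : ℝ := ‖C‖ ^ 2 * Real.exp (‖D‖ ^ 2) with hk
  have hk0 : 0 < k := by positivity
  have hf0 : q.fst = 0 := by
    -- The composition of $w\mapsto\overline Aw+\overline D$ with $z\mapsto Az+B$ is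
    -- $w\mapsto|A|^2w+A\overline D+B$, and the two weights multiply to $k\,e^{\overline\beta w}$.
    refine Fock.eq_zero_of_comp_affine_eq (α := ‖A‖ ^ 2) (β := A * conj D + B) (k := k⁻¹)
      (by positivity) (by positivity) fun w => ?_
    have h1 := horth w
    rw [hqG, show A * (conj A * w + conj D) + B = ((‖A‖ ^ 2 : ℝ) : ℂ) * w + (A * conj D + B) by
      push_cast; rw [← mul_conj']; ring] at h1
    have h2 : exp (conj B * w) * exp (D * (conj A * w + conj D)) * exp (-conj (A * conj D + B) * w)
        = exp ((‖D‖ : ℂ) ^ 2) := by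
      rw [← exp_add, ← exp_add, ← mul_conj']
      simp only [map_add, map_mul, conj_conj]
      ring_nf
    have h3 : (k : ℂ) = C * conj C * exp ((‖D‖ : ℂ) ^ 2) := by
      rw [hk, mul_conj']; push_cast; ring
    have h4 : (k : ℂ) ≠ 0 := by exact_mod_cast hk0.ne'
    refine mul_left_cancel₀ h4 ?_
    rw [ofReal_inv, ← mul_assoc, ← mul_assoc, mul_neg, mul_inv_cancel₀ h4, h3, ← h2]
    linear_combination exp (-conj (A * conj D + B) * w) * h1
  have hq0 : q = 0 := by
    have hs : q.snd = 0 := Fock.ext fun z => by simp [hqG, hf0]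
    exact (WithLp.ofLp_injective 2) (Prod.ext hf0 hs)
  rw [hq, sub_eq_zero] at hq0
  rw [hq0]
  exact K.topologicalClosure.starProjection_apply_mem p

/-- The claim says that $(-g',g)$ is orthogonal to $(f,f')$. Against kernel pairs this is
`inner_imageKernel`; the core property extends it to the whole graph. -/
theorem inner_eq_inner_of_affine (hC : C ≠ 0) {f f' g g' : Fock}
    (hf : ∀ z, f' z = C * exp (D * z) * f (A * z + B))
    (hg : ∀ z, g' z = conj C * exp (conj B * z) * g (conj A * z + conj D)) :
    inner ℂ f' g = inner ℂ f g' := by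
  have h1 : WithLp.toLp 2 (-g', g) ∈ (Submodule.span ℂ (Set.range fun w =>
      WithLp.toLp 2 (Fock.kernel w, imageKernel A B C D w)))ᗮ := by
    rw [Submodule.mem_orthogonal]
    intro u hu
    induction hu using Submodule.span_induction with
    | mem u hu =>
      obtain ⟨w, rfl⟩ := hu
      rw [WithLp.prod_inner_apply]
      change inner ℂ (Fock.kernel w) (-g') + inner ℂ (imageKernel A B C D w) g = 0
      rw [inner_neg_right, Fock.inner_kernel, inner_imageKernel, hg]
      ring
    | zero => simp
    | add x y _ _ hx hy => rw [inner_add_left, hx, hy, add_zero]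
    | smul a x _ hx => rw [inner_smul_left, hx, mul_zero]
  rw [← Submodule.orthogonal_closure] at h1
  have h2 := h1 _ (mem_topologicalClosure_span_kernel hC hf)
  rw [WithLp.prod_inner_apply] at h2
  change inner ℂ f (-g') + inner ℂ f' g = 0 at h2
  rw [inner_neg_right] at h2
  linear_combination h2

/-- The adjoint of the maximal weighted composition operator with affine symbols. -/
theorem maximalWCO_affine_adjoint (hC : C ≠ 0) :
    (maximalWCO (fun z => C * exp (D * z)) fun z => A * z + B).adjoint =
      maximalWCO (fun z => conj C * exp (conj B * z)) fun z => conj A * z + conj D := by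
  set T := maximalWCO (fun z => C * exp (D * z)) fun z => A * z + B with hT
  have hd : Dense (T.domain : Set Fock) := maximalWCO_affine_dense
  have hadj : ∀ (y : T.adjoint.domain) (z : ℂ),
      T.adjoint y z = conj C * exp (conj B * z) * y.1 (conj A * z + conj D) := by
    intro y z
    -- Testing the adjoint against kernels recovers its pointwise values.
    have h1 := LinearPMap.adjoint_isFormalAdjoint hd y ⟨Fock.kernel z, kernel_mem_domain z⟩
    have h2 : T ⟨Fock.kernel z, kernel_mem_domain z⟩ = imageKernel A B C D z :=
      maximalWCO_eq_of_forall (imageKernel_apply A B C D z)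
    rw [h2] at h1
    rw [← inner_imageKernel, ← Fock.inner_kernel, ← inner_conj_symm, ← inner_conj_symm _ y.1]
    exact congrArg _ h1
  refine le_antisymm (LinearPMap.le_of_le_graph fun p hp => ?_) ?_
  · obtain ⟨y, hy1, hy2⟩ := (LinearPMap.mem_graph_iff _).1 hp
    rw [mem_maximalWCO_graph_iff, ← hy1, ← hy2]
    exact hadj y
  · refine LinearPMap.IsFormalAdjoint.le_adjoint hd fun f g => ?_
    exact inner_eq_inner_of_affine hC (fun z => rfl) (fun z => rfl)

end Affine

/-! ### Normality of operators with affine symbols -/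

section Affine

variable {A B C D : ℂ}

/-- Equality of the Gram matrices of $TK_w$ and $T^*K_w$. Comparing exponents, the terms in $v$ and
in $\overline w$ need `h` and its conjugate, and the constant term needs $|B|=|D|$. -/
theorem inner_imageKernel_imageKernel_comm (hBD : ‖B‖ = ‖D‖)
    (h : conj B * (1 - A) = D * (1 - conj A)) (v w : ℂ) :
    inner ℂ (imageKernel A B C D v) (imageKernel A B C D w) =
      inner ℂ (imageKernel (conj A) (conj D) (conj C) (conj B) v)
        (imageKernel (conj A) (conj D) (conj C) (conj B) w) := by
  have hBD' : conj B * B = D * conj D := by rw [conj_mul', mul_conj', hBD]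
  have h' : B * (1 - conj A) = conj D * (1 - A) := by simpa using congrArg conj h
  simp only [inner_imageKernel, imageKernel_apply, Fock.kernel_apply, conj_conj]
  have e : exp (conj B * v) * exp (D * (conj A * v + conj D)) *
        exp (conj w * (A * (conj A * v + conj D) + B)) =
      exp (D * v) * exp (conj B * (A * v + B)) *
        exp (conj w * (conj A * (A * v + B) + conj D)) := by
    simp only [← exp_add]
    congr 1
    linear_combination v * h - hBD' + conj w * h'
  linear_combination C * conj C * e

/-- The maximal operator `T` and its adjoint `S` have the same domain and satisfy `‖T f‖ = ‖S f‖`,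
since this holds on the span of the kernels. -/
theorem exists_adjoint_image (hC : C ≠ 0) (hBD : ‖B‖ = ‖D‖)
    (h : conj B * (1 - A) = D * (1 - conj A)) {f g : Fock}
    (hf : ∀ z, g z = C * exp (D * z) * f (A * z + B)) :
    ∃ g' : Fock, (∀ z, g' z = conj C * exp (conj B * z) * f (conj A * z + conj D)) ∧
      ‖g'‖ = ‖g‖ := by
  set k := Finsupp.linearCombination ℂ Fock.kernel with hk
  set t := Finsupp.linearCombination ℂ (imageKernel A B C D) with ht
  set s := Finsupp.linearCombination ℂ
    (imageKernel (conj A) (conj D) (conj C) (conj B)) with hs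
  have hst : ∀ c, ‖s c‖ = ‖t c‖ := by
    intro c
    rw [@norm_eq_sqrt_re_inner ℂ, @norm_eq_sqrt_re_inner ℂ _ _ _ _ (t c)]
    simp only [hs, ht, Finsupp.linearCombination_apply, Finsupp.sum, sum_inner, inner_sum,
      inner_smul_left, inner_smul_right, inner_imageKernel_imageKernel_comm hBD h]
  have hsk : ∀ c z, s c z = conj C * exp (conj B * z) * k c (conj A * z + conj D) := by
    intro c z
    induction c using Finsupp.induction_linear with
    | zero => simp
    | add c d hc hd => simp only [map_add, Fock.coe_add, Pi.add_apply, hc, hd]; ring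
    | single w a =>
      simp only [hs, hk, Finsupp.linearCombination_single, Fock.coe_smul, Pi.smul_apply,
        imageKernel_apply, smul_eq_mul]
      ring
  have hspan : ∀ x ∈ Submodule.span ℂ (Set.range fun w =>
      WithLp.toLp 2 (Fock.kernel w, imageKernel A B C D w)),
      ∃ c, x = WithLp.toLp 2 (k c, t c) := by
    intro x hx
    induction hx using Submodule.span_induction with
    | mem u hu =>
      obtain ⟨w, rfl⟩ := hu
      exact ⟨Finsupp.single w 1, by simp [hk, ht]⟩
    | zero => exact ⟨0, by simp; rfl⟩
    | add x y _ _ hx hy =>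
      obtain ⟨c, rfl⟩ := hx
      obtain ⟨d, rfl⟩ := hy
      exact ⟨c + d, by simp only [map_add]; rfl⟩
    | smul a x _ hx =>
      obtain ⟨c, rfl⟩ := hx
      exact ⟨a • c, by simp only [map_smul]; rfl⟩
  have hcl := mem_topologicalClosure_span_kernel hC hf
  rw [← SetLike.mem_coe, Submodule.topologicalClosure_coe, mem_closure_iff_seq_limit] at hcl
  obtain ⟨x, hx, hlim⟩ := hcl
  choose c hc using fun n => hspan _ (hx n)
  replace hlim := hlim.congr hc
  have hlim' := ((WithLp.prod_continuous_ofLp 2 Fock Fock).tendsto _).comp hlim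
  have hkl : Tendsto (fun n => k (c n)) atTop (𝓝 f) := (continuous_fst.tendsto _).comp hlim'
  have htl : Tendsto (fun n => t (c n)) atTop (𝓝 g) := (continuous_snd.tendsto _).comp hlim'
  -- On combinations of kernels $T$ and its adjoint have equal norms, so convergence of the images
  -- under $T$ makes the adjoint images Cauchy; point evaluations then identify the limit.
  have hcau : CauchySeq fun n => s (c n) := by
    have h1 := htl.cauchySeq
    rw [Metric.cauchySeq_iff] at h1 ⊢
    simpa only [dist_eq_norm, ← map_sub, hst] using h1
  obtain ⟨g', hg'⟩ := cauchySeq_tendsto_of_complete hcau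
  refine ⟨g', fun z => ?_, ?_⟩
  · refine tendsto_nhds_unique (((Fock.continuous_apply z).tendsto _).comp hg') ?_
    simp only [Function.comp_def, hsk]
    exact (((Fock.continuous_apply _).tendsto _).comp hkl).const_mul _
  · refine tendsto_nhds_unique hg'.norm ?_
    simp only [hst]
    exact htl.norm

theorem isNormalOperator_maximalWCO_affine (hC : C ≠ 0) (hBD : ‖B‖ = ‖D‖)
    (h : conj B * (1 - A) = D * (1 - conj A)) :
    IsNormalOperator (maximalWCO (fun z => C * exp (D * z)) fun z => A * z + B) := by
  refine ⟨maximalWCO_isClosed _ _, maximalWCO_affine_dense, ?_⟩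
  rw [maximalWCO_affine_adjoint hC]
  refine ⟨le_antisymm (fun f hf => ?_) (fun f hf => ?_), fun f hf hf' => ?_⟩
  · obtain ⟨g, hg⟩ := mem_maximalWCO_domain_iff.1 hf
    obtain ⟨g', hg', -⟩ := exists_adjoint_image hC hBD h hg
    exact mem_maximalWCO_domain_iff.2 ⟨g', hg'⟩
  · obtain ⟨g, hg⟩ := mem_maximalWCO_domain_iff.1 hf
    obtain ⟨g', hg', -⟩ := exists_adjoint_image (A := conj A) (B := conj D) (C := conj C)
      (D := conj B) (by simpa using hC) (by simpa using hBD.symm) (by simpa using h.symm) hg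
    exact mem_maximalWCO_domain_iff.2 ⟨g', by simpa using hg'⟩
  · obtain ⟨g', hg', hn⟩ := exists_adjoint_image hC hBD h
      (maximalWCO_apply (ψ := fun z => C * exp (D * z)) (φ := fun z => A * z + B) ⟨f, hf⟩)
    rw [maximalWCO_eq_of_forall (f := ⟨f, hf'⟩) hg', hn]

end Affine

/-! ### Symbols of normal operators -/

/-- The reproducing property gives $T^*K_w=\overline{\psi(w)}K_{\varphi(w)}$ for arbitrary symbols;
normality transfers membership in the domain and the norm to $T$. -/
theorem exists_norm_image_kernel_of_isNormalOperator {ψ φ : ℂ → ℂ}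
    (h : IsNormalOperator (maximalWCO ψ φ)) (w : ℂ) :
    ∃ g : Fock, (∀ z, g z = ψ z * Fock.kernel w (φ z)) ∧
      ‖g‖ = ‖ψ w‖ * Real.exp (‖φ w‖ ^ 2 / 2) := by
  obtain ⟨-, hd, hdom, hnorm⟩ := h
  have h1 : ∀ x : (maximalWCO ψ φ).domain, inner ℂ (conj (ψ w) • Fock.kernel (φ w)) x.1 =
      inner ℂ (Fock.kernel w) (maximalWCO ψ φ x) := by
    intro x
    rw [inner_smul_left, Fock.inner_kernel, Fock.inner_kernel, conj_conj, maximalWCO_apply]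
  have hw : Fock.kernel w ∈ (maximalWCO ψ φ).adjoint.domain :=
    LinearPMap.mem_adjoint_domain_of_exists _ ⟨_, h1⟩
  have hw' : Fock.kernel w ∈ (maximalWCO ψ φ).domain := hdom ▸ hw
  refine ⟨maximalWCO ψ φ ⟨_, hw'⟩, fun z => rfl, ?_⟩
  rw [hnorm _ hw' hw, LinearPMap.adjoint_apply_eq hd ⟨_, hw⟩ h1, norm_smul, RCLike.norm_conj,
    Fock.norm_kernel]

theorem exists_eq_exp_of_differentiable {ψ : ℂ → ℂ} (hd : Differentiable ℂ ψ) (h0 : ∀ z, ψ z ≠ 0) :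
    ∃ q : ℂ → ℂ, Differentiable ℂ q ∧ ∀ z, ψ z = exp (q z) := by
  have hd' : Differentiable ℂ fun z => deriv ψ z / ψ z := by
    intro z
    exact ((hd.contDiff (n := 2)).differentiable_deriv_two z).div (hd z) (h0 z)
  obtain ⟨p, hp⟩ := hd'.isExactOn_univ
  have hp' : ∀ z, HasDerivAt p (deriv ψ z / ψ z) z := fun z => hp z (Set.mem_univ z)
  have hpd : Differentiable ℂ p := fun z => (hp' z).differentiableAt
  have hconst : ∀ z, ψ z * exp (-p z) = ψ 0 * exp (-p 0) := by
    intro z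
    refine is_const_of_deriv_eq_zero (by fun_prop : Differentiable ℂ fun z => ψ z * exp (-p z))
      (fun z => ?_) z 0
    have h1 := (hd z).hasDerivAt.mul (hp' z).neg.cexp
    refine HasDerivAt.deriv (h1.congr_deriv ?_)
    have := h0 z
    field_simp
    ring
  have hne : ψ 0 * exp (-p 0) ≠ 0 := mul_ne_zero (h0 0) (exp_ne_zero _)
  refine ⟨fun z => p z + log (ψ 0 * exp (-p 0)), by fun_prop, fun z => ?_⟩
  rw [exp_add, exp_log hne, ← hconst z, mul_comm, mul_assoc, ← exp_add, neg_add_cancel, exp_zero,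
    mul_one]

/-- Borel–Carathéodory on the disc of radius $2R$ gives $|g|\le KR^2$ on $|z|=R$; Cauchy's estimates
then kill all derivatives at $0$ of order at least $3$. -/
theorem exists_eq_quadratic_of_re_le {g : ℂ → ℂ} (hd : Differentiable ℂ g) {M : ℝ}
    (hM : ∀ z, (g z).re ≤ M + ‖z‖ ^ 2 / 2) : ∃ a b c : ℂ, ∀ z, g z = a * z ^ 2 + b * z + c := by
  set K : ℝ := 2 * (|M| + 1 + 2) + 3 * ‖g 0‖ with hK
  have hK0 : 0 ≤ K := by positivity
  have hgrowth : ∀ R : ℝ, 1 ≤ R → ∀ z ∈ Metric.sphere (0 : ℂ) R, ‖g z‖ ≤ K * R ^ 2 := by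
    intro R hR z hz
    have hz' : ‖z‖ = R := by simpa using hz
    have h1 := Complex.borelCaratheodory (f := g) (M := |M| + 1 + 2 * R ^ 2) (R := 2 * R) (z := z)
      (by positivity) hd.differentiableOn (fun u hu => ?_) (by linarith)
      (by rw [mem_ball_zero_iff, hz']; linarith)
    · rw [hz', show 2 * R - R = R by ring, mul_div_assoc, div_self (by linarith),
        show ‖g 0‖ * (2 * R + R) / R = 3 * ‖g 0‖ by field_simp; ring] at h1
      have hR2 : 1 ≤ R ^ 2 := by nlinarith
      have := mul_le_mul_of_nonneg_left hR2 (abs_nonneg M)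
      have := mul_le_mul_of_nonneg_left hR2 (norm_nonneg (g 0))
      rw [hK]
      linarith
    · have h2 : ‖u‖ ≤ 2 * R := (mem_ball_zero_iff.1 hu).le
      have h3 : ‖u‖ ^ 2 ≤ (2 * R) ^ 2 := by gcongr
      have := hM u
      rw [Set.mem_ofPred_eq]
      linarith [le_abs_self M]
  have hder : ∀ n, 3 ≤ n → iteratedDeriv n g 0 = 0 := by
    intro n hn
    have h1 : ∀ R : ℝ, 1 ≤ R → ‖iteratedDeriv n g 0‖ ≤ n.factorial * K / R := by
      intro R hR
      have hR0 : 0 < R := by linarith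
      refine (Complex.norm_iteratedDeriv_le_of_forall_mem_sphere_norm_le n hR0 hd.diffContOnCl
        (hgrowth R hR)).trans ?_
      have h2 : R ^ 3 ≤ R ^ n := pow_le_pow_right₀ hR hn
      calc n.factorial * (K * R ^ 2) / R ^ n ≤ n.factorial * (K * R ^ 2) / R ^ 3 := by gcongr
        _ = n.factorial * K / R := by field_simp
    have h2 : Tendsto (fun R : ℝ => n.factorial * K / R) atTop (𝓝 0) :=
      tendsto_const_nhds.div_atTop tendsto_id
    have h3 : ‖iteratedDeriv n g 0‖ ≤ 0 :=
      ge_of_tendsto h2 ((eventually_ge_atTop 1).mono h1)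
    simpa using h3
  refine ⟨((2 : ℕ).factorial : ℂ)⁻¹ * iteratedDeriv 2 g 0, iteratedDeriv 1 g 0,
    iteratedDeriv 0 g 0, fun z => ?_⟩
  rw [← Complex.taylorSeries_eq_of_entire' 0 z hd, tsum_eq_sum (s := Finset.range 3)]
  · simp [Finset.sum_range_succ]
    ring
  · intro n hn
    rw [hder n (by simpa using hn)]
    simp

theorem nonpos_of_forall_quadratic_le {x y m : ℝ} (h : ∀ t : ℝ, x * t ^ 2 + y * t ≤ m) : x ≤ 0 := by
  by_contra! hx
  -- Opposite values of $t$ cancel the linear term, and $x(1+|m|/x)^2>m$.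
  have h1 := h (1 + |m| / x)
  have h2 := h (-(1 + |m| / x))
  have h3 : x * (|m| / x) = |m| := by field_simp
  nlinarith [le_abs_self m, abs_nonneg m, div_nonneg (abs_nonneg m) hx.le,
    mul_nonneg (abs_nonneg m) (div_nonneg (abs_nonneg m) hx.le)]

theorem eq_zero_of_forall_re_mul_le {p : ℂ} {m : ℝ} (h : ∀ w : ℂ, (p * w).re ≤ m) : p = 0 := by
  have h1 : ‖p‖ ^ 2 ≤ 0 := by
    refine nonpos_of_forall_quadratic_le (y := 0) (m := m) fun t => ?_
    have h2 := h (conj p * (t ^ 2 : ℝ))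
    rw [← mul_assoc, mul_conj', ← ofReal_pow, ← ofReal_mul, ofReal_re] at h2
    linarith
  simpa using le_antisymm h1 (sq_nonneg _)

theorem eq_zero_of_forall_re_mul_sq_le {p : ℂ} {m : ℝ} (h : ∀ w : ℂ, (p * w ^ 2).re ≤ m) :
    p = 0 := by
  refine eq_zero_of_forall_re_mul_le (m := m) fun w => ?_
  obtain ⟨u, hu⟩ := IsAlgClosed.exists_pow_nat_eq w two_pos
  rw [← hu]
  exact h u

/-- A pair of entire symbols satisfying the growth bound forced by normality consists of an
exponential and an affine function. -/
theorem exists_affine_of_growth {ψ φ : ℂ → ℂ} (hψ : Differentiable ℂ ψ) (hφ : Differentiable ℂ φ)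
    (h0 : ψ ≠ 0)
    (hb : ∀ w z, ‖ψ z‖ * Real.exp (conj w * φ z).re ≤
      ‖ψ w‖ * Real.exp (‖φ w‖ ^ 2 / 2) * Real.exp (‖z‖ ^ 2 / 2)) :
    ∃ A B C D : ℂ, C ≠ 0 ∧ (∀ z, φ z = A * z + B) ∧ ∀ z, ψ z = C * exp (D * z) := by
  have hne : ∀ w, ψ w ≠ 0 := by
    intro w hw
    refine h0 (funext fun z => ?_)
    have h1 := hb w z
    rw [hw, norm_zero, zero_mul, zero_mul] at h1
    have h2 : ‖ψ z‖ ≤ 0 := by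
      by_contra! h3
      exact absurd h1 (not_le.2 (by positivity))
    simpa using h2
  obtain ⟨q, hq, hψq⟩ := exists_eq_exp_of_differentiable hψ hne
  have hre : ∀ w z, (q z).re + (conj w * φ z).re ≤
      (q w).re + ‖φ w‖ ^ 2 / 2 + ‖z‖ ^ 2 / 2 := by
    intro w z
    have h1 := hb w z
    rwa [hψq, hψq, norm_exp, norm_exp, ← Real.exp_add, ← Real.exp_add, ← Real.exp_add,
      Real.exp_le_exp] at h1
  -- The choices $w=0$ and $w=1$ bound the real parts of $q$ and $q+\varphi$, so both are quadratic
  -- and hence so is $\varphi$.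
  obtain ⟨a, D, c, hqe⟩ := exists_eq_quadratic_of_re_le hq (M := (q 0).re + ‖φ 0‖ ^ 2 / 2)
    fun z => by simpa using hre 0 z
  obtain ⟨a', D', c', hqe'⟩ := exists_eq_quadratic_of_re_le (g := fun z => q z + φ z) (by fun_prop)
    (M := (q 1).re + ‖φ 1‖ ^ 2 / 2) fun z => by simpa using hre 1 z
  obtain ⟨e, A, B, hφe⟩ : ∃ e A B : ℂ, ∀ z, φ z = e * z ^ 2 + A * z + B :=
    ⟨a' - a, D' - D, c' - c, fun z => by linear_combination hqe' z - hqe z⟩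
  -- Compare $t^2$-coefficients at $z=t$ real. The bound is uniform in $w$, so $e$ must vanish.
  have hscale : ∀ w : ℂ, ((a + conj w * e)).re ≤ 1 / 2 := by
    intro w
    have h1 : ((a + conj w * e)).re - 1 / 2 ≤ 0 := by
      refine nonpos_of_forall_quadratic_le (y := (D + conj w * A).re)
        (m := (q w).re + ‖φ w‖ ^ 2 / 2 - (c + conj w * B).re) fun t => ?_
      have h2 := hre w t
      rw [← add_re, hqe, hφe, show a * (t : ℂ) ^ 2 + D * t + c + conj w * (e * t ^ 2 + A * t + B) =
        (a + conj w * e) * (t ^ 2 : ℝ) + (D + conj w * A) * t + (c + conj w * B) by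
          push_cast; ring, add_re, add_re, re_mul_ofReal, re_mul_ofReal, norm_real,
        Real.norm_eq_abs, sq_abs] at h2
      linarith
    linarith
  have he : e = 0 := by
    refine eq_zero_of_forall_re_mul_le (m := 1 / 2 - a.re) fun w => ?_
    have h1 := hscale (conj w)
    rw [conj_conj, add_re, mul_comm w] at h1
    linarith
  have hφa : ∀ z, φ z = A * z + B := fun z => by rw [hφe, he]; ring
  -- The homogeneous quadratic part of `hre`, extracted by scaling $(w,z)$ by real $t$.
  have hquad : ∀ w z : ℂ, (a * z ^ 2 + conj w * (A * z) - a * w ^ 2).re -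
      ‖A * w‖ ^ 2 / 2 - ‖z‖ ^ 2 / 2 ≤ 0 := by
    intro w z
    refine nonpos_of_forall_quadratic_le
      (y := (D * z + conj w * B - D * w).re - (A * w * conj B).re)
      (m := ‖B‖ ^ 2 / 2) fun t => ?_
    have h2 := hre (t * w) (t * z)
    rw [hqe, hqe, hφa, hφa] at h2
    have h3 : ‖A * (t * w) + B‖ ^ 2 = t ^ 2 * ‖A * w‖ ^ 2 + ‖B‖ ^ 2 +
        2 * (t * (A * w * conj B).re) := by
      rw [Complex.sq_norm, normSq_add, ← Complex.sq_norm, ← Complex.sq_norm,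
        show A * (t * w) = t * (A * w) by ring, norm_mul, norm_real, mul_pow, Real.norm_eq_abs,
        sq_abs, mul_assoc (t : ℂ), re_ofReal_mul]
    have h4 : ‖(t : ℂ) * z‖ ^ 2 = t ^ 2 * ‖z‖ ^ 2 := by
      rw [norm_mul, norm_real, mul_pow, Real.norm_eq_abs, sq_abs]
    have h5 : (a * (t * z) ^ 2 + D * (t * z) + c).re + (conj (t * w) * (A * (t * z) + B)).re -
        (a * (t * w) ^ 2 + D * (t * w) + c).re =
        (a * z ^ 2 + conj w * (A * z) - a * w ^ 2).re * t ^ 2 +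
          (D * z + conj w * B - D * w).re * t := by
      rw [← add_re, ← sub_re, ← re_mul_ofReal, ← re_mul_ofReal, ← add_re, map_mul,
        conj_ofReal]
      congr 1
      push_cast
      ring
    rw [h3, h4] at h2
    linarith
  -- At $z=\overline Aw$ the Gaussian terms cancel exactly, so perturbing by $\varepsilon$ isolates
  -- $a$; $\varepsilon=0$ and $\varepsilon=1$ suffice to give $a=0$.
  have hdiff : ∀ w ε : ℂ, (a * ((conj A ^ 2 - 1) * w ^ 2 + 2 * conj A * w * ε + ε ^ 2)).re ≤
      ‖ε‖ ^ 2 / 2 := by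
    intro w ε
    have h1 := hquad w (conj A * w + ε)
    have h2 : ‖conj A * w + ε‖ ^ 2 = ‖A * w‖ ^ 2 + ‖ε‖ ^ 2 + 2 * (conj A * w * conj ε).re := by
      rw [Complex.sq_norm, normSq_add, ← Complex.sq_norm, ← Complex.sq_norm, norm_mul,
        RCLike.norm_conj, norm_mul]
    have h3 : (conj w * (A * (conj A * w + ε))).re = ‖A * w‖ ^ 2 + (conj A * w * conj ε).re := by
      rw [show conj w * (A * (conj A * w + ε)) = (A * w) * conj (A * w) +
        conj (conj A * w * conj ε) by simp only [map_mul, conj_conj]; ring, mul_conj', add_re,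
        conj_re, ← ofReal_pow, ofReal_re]
    rw [sub_re, add_re, h3, h2] at h1
    rw [show a * ((conj A ^ 2 - 1) * w ^ 2 + 2 * conj A * w * ε + ε ^ 2) =
      a * (conj A * w + ε) ^ 2 - a * w ^ 2 by ring, sub_re]
    linarith
  have ha1 : a * (conj A ^ 2 - 1) = 0 := by
    refine eq_zero_of_forall_re_mul_sq_le (m := 0) fun w => ?_
    have := hdiff w 0
    simpa [mul_assoc] using this
  have ha2 : 2 * a * conj A = 0 := by
    refine eq_zero_of_forall_re_mul_le (m := 1 / 2 - a.re) fun w => ?_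
    have h1 := hdiff w 1
    rw [show a * ((conj A ^ 2 - 1) * w ^ 2 + 2 * conj A * w * 1 + 1 ^ 2) =
      2 * a * conj A * w + a by linear_combination w ^ 2 * ha1, add_re, norm_one] at h1
    linarith
  have ha : a = 0 := by linear_combination (conj A / 2) * ha2 - ha1
  refine ⟨A, B, exp c, D, exp_ne_zero _, hφa, fun z => ?_⟩
  rw [hψq, hqe, ha, ← exp_add]
  ring_nf

/-- After taking logarithms the terms $|Aw|^2/2$ cancel; the constant term gives $|B|=|D|$ and the
remaining real-linear form in $w$ must vanish. -/
theorem affine_condition_of_norm_imageKernel {A B C D : ℂ} (hC : C ≠ 0)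
    (h : ∀ w, ‖imageKernel A B C D w‖ =
      ‖C * exp (D * w)‖ * Real.exp (‖A * w + B‖ ^ 2 / 2)) :
    ‖B‖ = ‖D‖ ∧ conj B * (1 - A) = D * (1 - conj A) := by
  have hC' : 0 < ‖C‖ := norm_pos_iff.2 hC
  have h1 : ∀ w, (conj w * B).re + ‖conj D + w * conj A‖ ^ 2 / 2 =
      (D * w).re + ‖A * w + B‖ ^ 2 / 2 := by
    intro w
    have h2 := h w
    rw [imageKernel, norm_smul, norm_mul, norm_mul, Fock.norm_kernel, norm_exp, norm_exp,
      mul_assoc, mul_assoc] at h2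
    have h3 := mul_left_cancel₀ hC'.ne' h2
    rwa [← Real.exp_add, ← Real.exp_add, Real.exp_eq_exp] at h3
  have hBD : ‖B‖ = ‖D‖ := by
    have h2 := h1 0
    simp only [map_zero, zero_mul, mul_zero, zero_re, add_zero, zero_add, RCLike.norm_conj] at h2
    rw [← sq_eq_sq₀ (norm_nonneg _) (norm_nonneg _)]
    linarith
  refine ⟨hBD, ?_⟩
  rw [← sub_eq_zero]
  refine eq_zero_of_forall_re_mul_le (m := 0) fun w => le_of_eq ?_
  have h2 := h1 w
  rw [Complex.sq_norm, Complex.sq_norm, normSq_add, normSq_add, ← Complex.sq_norm,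
    ← Complex.sq_norm, ← Complex.sq_norm, ← Complex.sq_norm, norm_mul, norm_mul, RCLike.norm_conj,
    RCLike.norm_conj, hBD, ← conj_re (conj w * B), ← conj_re (conj D * _)] at h2
  simp only [map_mul, conj_conj] at h2
  rw [show (conj B * (1 - A) - D * (1 - conj A)) * w = w * conj B + D * (w * conj A) -
    D * w - A * w * conj B by ring]
  simp only [add_re, sub_re]
  linarith

/-- The condition on the coefficients of the symbols, in a form without case distinction. -/
theorem affine_condition_iff {A B D : ℂ} :
    ((A ≠ 1 ∧ D = conj B * (1 - A) * (1 - conj A)⁻¹) ∨ (A = 1 ∧ ‖B‖ = ‖D‖)) ↔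
      ‖B‖ = ‖D‖ ∧ conj B * (1 - A) = D * (1 - conj A) := by
  rcases eq_or_ne A 1 with rfl | hA
  · simp
  have h1 : 1 - conj A ≠ 0 := by
    rw [← map_one conj, ← map_sub]
    exact (map_ne_zero conj).2 (sub_ne_zero.2 hA.symm)
  simp only [ne_eq, hA, not_false_eq_true, true_and, false_and, or_false]
  constructor
  · intro h
    have h2 : conj B * (1 - A) = D * (1 - conj A) := by rw [h]; field_simp
    refine ⟨?_, h2⟩
    have h3 := congrArg norm h2
    have h4 : ‖1 - A‖ = ‖1 - conj A‖ := by rw [← RCLike.norm_conj (1 - A), map_sub, map_one]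
    rw [norm_mul, norm_mul, h4, RCLike.norm_conj] at h3
    exact mul_right_cancel₀ (norm_ne_zero_iff.2 h1) h3
  · rintro ⟨-, h⟩
    rw [h]
    field_simp

theorem isNormalOperator_maximalWCO_iff {ψ φ : ℂ → ℂ} (hψ : Differentiable ℂ ψ)
    (hφ : Differentiable ℂ φ) (h0 : ψ ≠ 0) :
    IsNormalOperator (maximalWCO ψ φ) ↔ ∃ A B C D : ℂ, HasNormalSymbols ψ φ A B C D := by
  constructor
  · intro h
    have hk := exists_norm_image_kernel_of_isNormalOperator h
    obtain ⟨A, B, C, D, hC, hφe, hψe⟩ := exists_affine_of_growth hψ hφ h0 fun w z => by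
      obtain ⟨g, hg, hn⟩ := hk w
      have h1 := Fock.norm_apply_le g z
      rwa [hg, hn, norm_mul, Fock.kernel_apply, norm_exp] at h1
    refine ⟨A, B, C, D, hφe, hψe, hC, affine_condition_iff.2 ?_⟩
    refine affine_condition_of_norm_imageKernel hC fun w => ?_
    obtain ⟨g, hg, hn⟩ := hk w
    have h1 : imageKernel A B C D w = g :=
      Fock.ext fun z => by rw [hg, hψe, hφe, imageKernel_apply]
    rw [h1, hn, hψe, hφe]
  · rintro ⟨A, B, C, D, hφe, hψe, hC, hc⟩
    obtain ⟨h1, h2⟩ := affine_condition_iff.1 hc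
    rw [funext hφe, funext hψe]
    exact isNormalOperator_maximalWCO_affine hC h1 h2

/-! ### The conjugations `f ↦ conj (f (conj (a z)))` -/

theorem Fock.norm_eq_eLpNorm (f : Fock) : ‖f‖ = (eLpNorm f 2 fockMeasure).toReal := by
  rw [← Fock.norm_toL2]
  exact Lp.norm_toLp _ f.memLp

theorem measurePreserving_conj_mul {a : ℂ} (ha : ‖a‖ = 1) :
    MeasurePreserving (fun z => conj (a * z)) fockMeasure fockMeasure :=
  measurePreserving_fockMeasure
    ((rotation ⟨a, by simpa [Submonoid.unitSphere] using ha⟩).trans conjLIE)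

theorem differentiable_conj_comp_conj_mul {f : ℂ → ℂ} (hf : Differentiable ℂ f) (a : ℂ) :
    Differentiable ℂ fun z => conj (f (conj (a * z))) := by
  have h : Differentiable ℂ (conj ∘ f ∘ conj) := fun z =>
    conj_conj z ▸ (hf (conj z)).conj_conj
  exact h.comp (by fun_prop : Differentiable ℂ fun z => a * z)

theorem memLp_conj_comp_conj_mul {a : ℂ} (ha : ‖a‖ = 1) (f : Fock) :
    MemLp (fun z => conj (f (conj (a * z)))) 2 fockMeasure :=
  (f.memLp.comp_measurePreserving (measurePreserving_conj_mul ha)).star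

/-- The conjugation `f ↦ conj (f (conj (a z)))` of the Fock space, for `|a| = 1`. -/
noncomputable def rotationConjugation {a : ℂ} (ha : ‖a‖ = 1) : Conjugation Fock where
  toFun :=
    { toFun := fun f => (⟨fun z => conj (f (conj (a * z))),
        differentiable_conj_comp_conj_mul f.differentiable a,
        memLp_conj_comp_conj_mul ha f⟩ : ↥fockSubmodule)
      map_add' := fun f g => Fock.ext fun z => map_add conj _ _
      map_smul' := fun c f => Fock.ext fun z => map_mul conj _ _
      norm_map' := fun f => by
        rw [Fock.norm_eq_eLpNorm, Fock.norm_eq_eLpNorm, ← eLpNorm_comp_measurePreserving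
          f.memLp.aestronglyMeasurable (measurePreserving_conj_mul ha)]
        congr 1
        exact eLpNorm_congr_norm_ae (Eventually.of_forall fun z => RCLike.norm_conj _) }
  involutive := fun f => Fock.ext fun z => by
    change conj (conj (f (conj (a * conj (a * z))))) = f z
    rw [conj_conj, map_mul, conj_conj, ← mul_assoc, conj_mul', ha]
    simp

theorem rotationConjugation_apply {a : ℂ} (ha : ‖a‖ = 1) (f : Fock) (z : ℂ) :
    rotationConjugation ha f z = conj (f (conj (a * z))) := rfl

theorem isWeightedCompositionConjugation_rotationConjugation {a : ℂ} (ha : ‖a‖ = 1) :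
    IsWeightedCompositionConjugation (rotationConjugation ha) a 0 1 where
  norm_a := ha
  ab := by simp
  bc := by simp
  apply_eq f z := by simp [rotationConjugation_apply]

theorem Conjugation.mem_sandwich_graph_iff {H : Type*} [NormedAddCommGroup H]
    [InnerProductSpace ℂ H] (𝒞 : Conjugation H) (S : H →ₗ.[ℂ] H) {p : H × H} :
    p ∈ (𝒞.sandwich S).graph ↔ (𝒞 p.1, 𝒞 p.2) ∈ S.graph := by
  rw [LinearPMap.mem_graph_iff, LinearPMap.mem_graph_iff]
  constructor
  · rintro ⟨y, h1, h2⟩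
    refine ⟨⟨𝒞 y.1, y.2⟩, congrArg 𝒞.toFun h1, ?_⟩
    rw [← h2]
    exact (𝒞.involutive _).symm
  · rintro ⟨y, h1, h2⟩
    simp only at h1 h2
    have hy : 𝒞 p.1 ∈ S.domain := h1 ▸ y.2
    refine ⟨⟨p.1, hy⟩, rfl, ?_⟩
    change 𝒞 (S ⟨𝒞 p.1, hy⟩) = p.2
    have h3 : (⟨𝒞 p.1, hy⟩ : S.domain) = y := Subtype.ext h1.symm
    rw [h3, h2, 𝒞.involutive]

theorem rotationConjugation_isSelfAdjoint {a A B C D : ℂ} (ha : ‖a‖ = 1) (hC : C ≠ 0)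
    (hD : D = a * B) : (rotationConjugation ha).IsSelfAdjoint
      (maximalWCO (fun z => C * exp (D * z)) fun z => A * z + B) := by
  refine ⟨maximalWCO_isClosed _ _, maximalWCO_affine_dense, LinearPMap.eq_of_eq_graph ?_⟩
  ext p
  rw [Conjugation.mem_sandwich_graph_iff, maximalWCO_affine_adjoint hC, mem_maximalWCO_graph_iff,
    mem_maximalWCO_graph_iff]
  have haa : a * conj a = 1 := by rw [mul_conj', ha]; simp
  -- The graph condition for $T$ may be tested at the points $\overline{az}$, where its two sides
  -- become the conjugates of those for $\mathcal CT^*\mathcal C$ as soon as $D=aB$.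
  have hsurj : Function.Surjective fun z => conj (a * z) := fun u =>
    ⟨conj (a * u), by
      simp only [map_mul, conj_conj]
      linear_combination u * haa⟩
  rw [hsurj.forall]
  refine forall_congr' fun z => ?_
  simp only [rotationConjugation_apply]
  rw [← (starRingEnd ℂ).injective.eq_iff]
  have h1 : D * conj (a * z) = conj (conj B * z) := by
    rw [hD]
    simp only [map_mul, conj_conj]
    linear_combination B * conj z * haa
  have h2 : A * conj (a * z) + B = conj (a * (conj A * z + conj D)) := by
    rw [hD]
    simp only [map_mul, map_add, conj_conj]
    linear_combination -B * haa
  rw [h1, h2, map_mul conj (C * _), map_mul conj C, exp_conj, conj_conj]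

/-! ### The parameters of the conjugation -/

/-- The parameter is chosen to solve $D=aB$, and $|a|=1$ follows from $|B|=|D|$ when $B\ne0$. If
$B=0$ then $D=0$, so every unimodular $a$ works and $1$ is a default. -/
theorem norm_normalParam {A B D : ℂ} (hBD : ‖B‖ = ‖D‖)
    (h : conj B * (1 - A) = D * (1 - conj A)) :
    ‖normalParam A B D‖ = 1 ∧ D = normalParam A B D * B := by
  have key : D = normalParam A B D * B := by
    unfold normalParam
    split_ifs with hB hA
    · rw [hB, norm_zero] at hBD
      rw [hB, norm_eq_zero.1 hBD.symm, mul_zero]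
    · field_simp
    · have h1 : 1 - conj A ≠ 0 := by
        rw [← map_one conj, ← map_sub]
        exact (map_ne_zero conj).2 (sub_ne_zero.2 (Ne.symm hA))
      rw [h]
      field_simp
  refine ⟨?_, key⟩
  rcases eq_or_ne B 0 with rfl | hB
  · simp [normalParam]
  · have h1 := congrArg norm key
    rw [norm_mul, ← hBD] at h1
    exact mul_right_cancel₀ (norm_ne_zero_iff.2 hB) (by rw [← h1, one_mul])

/-- The symbols determine the coefficients. -/
theorem HasNormalSymbols.unique {ψ φ : ℂ → ℂ} {A B C D A' B' C' D' : ℂ}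
    (h : HasNormalSymbols ψ φ A B C D) (hφ : ∀ z, φ z = A' * z + B')
    (hψ : ∀ z, ψ z = C' * exp (D' * z)) : A = A' ∧ B = B' ∧ C = C' ∧ D = D' := by
  have hB : B = B' := by simpa [h.phi_eq] using hφ 0
  have hA : A = A' := by simpa [h.phi_eq, hB] using hφ 1
  have hC : C = C' := by simpa [h.psi_eq] using hψ 0
  refine ⟨hA, hB, hC, ?_⟩
  have he : (fun z => exp (D * z)) = fun z => exp (D' * z) := by
    funext z
    have := hψ z
    rw [h.psi_eq, ← hC] at this
    exact mul_left_cancel₀ h.C_ne_zero this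
  have hd : ∀ E : ℂ, HasDerivAt (fun z => exp (E * z)) E 0 := fun E => by
    simpa using ((hasDerivAt_id (0 : ℂ)).const_mul E).cexp
  exact (hd D).unique (he ▸ hd D')

theorem exists_conjugation_of_isNormalOperator {ψ φ : ℂ → ℂ} (hψ : Differentiable ℂ ψ)
    (hφ : Differentiable ℂ φ) (h0 : ψ ≠ 0) (h : IsNormalOperator (maximalWCO ψ φ))
    {A B C D : ℂ} (hφe : ∀ z, φ z = A * z + B) (hψe : ∀ z, ψ z = C * exp (D * z)) :
    ∃ 𝒞 : Conjugation Fock, IsWeightedCompositionConjugation 𝒞 (normalParam A B D) 0 1 ∧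
      𝒞.IsSelfAdjoint (maximalWCO ψ φ) := by
  obtain ⟨A', B', C', D', hs⟩ := (isNormalOperator_maximalWCO_iff hψ hφ h0).1 h
  obtain ⟨rfl, rfl, rfl, rfl⟩ := hs.unique hφe hψe
  obtain ⟨h1, h2⟩ := affine_condition_iff.1 hs.cases
  obtain ⟨ha, hD⟩ := norm_normalParam h1 h2
  refine ⟨rotationConjugation ha, isWeightedCompositionConjugation_rotationConjugation ha, ?_⟩
  rw [funext hφe, funext hψe]
  exact rotationConjugation_isSelfAdjoint ha hs.C_ne_zero hD

theorem corollary6p5 :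
    (∀ ψ φ : ℂ → ℂ, Differentiable ℂ ψ → Differentiable ℂ φ → ψ ≠ 0 →
      (IsNormalOperator (maximalWCO ψ φ) ↔ ∃ A B C D : ℂ, HasNormalSymbols ψ φ A B C D) ∧
      (IsNormalOperator (maximalWCO ψ φ) →
        ∀ A B C D : ℂ, (∀ z, φ z = A * z + B) → (∀ z, ψ z = C * Complex.exp (D * z)) →
          ∃ 𝒞 : Conjugation Fock,
            IsWeightedCompositionConjugation 𝒞 (normalParam A B D) 0 1 ∧
            𝒞.IsSelfAdjoint (maximalWCO ψ φ))) ∧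
    {W : Fock →ₗ.[ℂ] Fock | ∃ ψ φ : ℂ → ℂ, Differentiable ℂ ψ ∧ Differentiable ℂ φ ∧ ψ ≠ 0 ∧
        W = maximalWCO ψ φ ∧ IsNormalOperator W} ⊂
      {W : Fock →ₗ.[ℂ] Fock | ∃ ψ φ : ℂ → ℂ, Differentiable ℂ ψ ∧ Differentiable ℂ φ ∧ ψ ≠ 0 ∧
        W = maximalWCO ψ φ ∧ ∃ (a b c : ℂ) (𝒞 : Conjugation Fock),
          IsWeightedCompositionConjugation 𝒞 a b c ∧ 𝒞.IsSelfAdjoint W} := by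
  refine ⟨fun ψ φ hψ hφ h0 => ⟨isNormalOperator_maximalWCO_iff hψ hφ h0, fun h A B C D hφe hψe =>
    exists_conjugation_of_isNormalOperator hψ hφ h0 h hφe hψe⟩, ?_⟩
  rw [Set.ssubset_iff_exists]
  constructor
  · rintro W ⟨ψ, φ, hψ, hφ, h0, rfl, h⟩
    obtain ⟨A, B, C, D, hs⟩ := (isNormalOperator_maximalWCO_iff hψ hφ h0).1 h
    obtain ⟨𝒞, h1, h2⟩ :=
      exists_conjugation_of_isNormalOperator hψ hφ h0 h hs.phi_eq hs.psi_eq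
    exact ⟨ψ, φ, hψ, hφ, h0, rfl, _, _, _, 𝒞, h1, h2⟩
  · -- The rank one operator `f ↦ f 1 • exp (-z)`.
    have hψ : Differentiable ℂ fun z : ℂ => (1 : ℂ) * exp (-1 * z) := by fun_prop
    have hφ : Differentiable ℂ fun z : ℂ => (0 : ℂ) * z + 1 := by fun_prop
    have h0 : (fun z : ℂ => (1 : ℂ) * exp (-1 * z)) ≠ 0 := fun h => by
      simpa using congrFun h 0
    have ha : ‖(-1 : ℂ)‖ = 1 := by simp
    refine ⟨maximalWCO (fun z => 1 * exp (-1 * z)) fun z => 0 * z + 1,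
      ⟨_, _, hψ, hφ, h0, rfl, -1, 0, 1, rotationConjugation ha,
        isWeightedCompositionConjugation_rotationConjugation ha,
        rotationConjugation_isSelfAdjoint ha one_ne_zero (by norm_num)⟩, ?_⟩
    rintro ⟨-, -, -, -, -, -, h⟩
    obtain ⟨A, B, C, D, hs⟩ := (isNormalOperator_maximalWCO_iff hψ hφ h0).1 h
    obtain ⟨rfl, rfl, rfl, rfl⟩ := hs.unique (fun z => rfl) (fun z => rfl)
    -- With $A=0$, $B=1$, $D=-1$ the relation $\overline B(1-A)=D(1-\overline A)$ reads $1=-1$,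
    -- although $D=aB$ holds with $a=-1$.
    obtain ⟨-, h2⟩ := affine_condition_iff.1 hs.cases
    norm_num at h2
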